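/- Let $\mathbb D$ be the open unit disk, $n\ge 1$, let $F=\{\sigma_1,\dots,\sigma_n\}\subset\partial\mathbb D$ consist of $n$ distinct points, $\Lambda=(\lambda_1,\dots,\lambda_n)\in(-\infty,0)^n$ and $\tau\in\partial\mathbb D\setminus F$. A one-parameter semigroup is a family $(\phi_t)_{t\ge0}$ of holomorphic self-maps of $\mathbb D$ with $\phi_0=\mathrm{id}$, $\phi_{s+t}=\phi_s\circ\phi_t$ and $\phi_t(z)\to z$ as $t\to0^+$ for each $z\in\mathbb D$; its infinitesimal generator is the holomorphic $G:\mathbb D\to\mathbb C$ with $\frac{d}{dt}\phi_t(z)=G(\phi_t(z))$ for all $z\in\mathbb D$, $t\ge0$. A point $\sigma\in\partial\mathbb D$ is a boundary regular fixed point (BRFP) of a holomorphic self-map $\varphi$ if the angular limit of $\varphi$ at $\sigma$ is $\sigma$ and the angular derivative $\varphi'(\sigma)=\angle\lim_{z\to\sigma}\frac{\varphi(z)-\sigma}{z-\sigma}$ exists finitely; it is a BRFP of $(\phi_t)$ if it is one of every $\phi_t$, and then the spectral value of $(\phi_t)$ at $\sigma$ is $\angle\lim_{z\to\sigma}\frac{G(z)}{\sigma-z}$.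 A point $\tau\in\partial\mathbb D$ is the Denjoy–Wolff point (DW-point) of $\varphi\ne\mathrm{id}$ if $\varphi$ has no fixed point in $\mathbb D$ and $\tau$ is a BRFP of $\varphi$ with $\varphi'(\tau)\le1$. Let $\mathrm{Gen}_\tau(F,\Lambda)$ be the class of all infinitesimal generators $G$ of one-parameter semigroups $(\phi_t)$ such that $\tau$ is the DW-point of every $\phi_t\neq\mathrm{id}$ and, for each $k$, $\sigma_k$ is a BRFP of $(\phi_t)$ with spectral value in $[\lambda_k,0]$ (so $G\equiv0$ belongs to the class). Each $G\in\mathrm{Gen}_\tau(F,\Lambda)$ has a well-defined spectral value $\lambda(G)\in\mathbb R$ at $\tau$, namely the unique real number with $\phi_t'(\tau)=e^{-\lambda(G)t}$ (angular derivative) for all $t\ge0$. Put $$\alpha_k=\frac{|\tau-\sigma_k|^2}{2|\lambda_k|},\quad p_0(z)=\sum_{k=1}^n\alpha_k\frac{\sigma_k+z}{\sigma_k-z},\quad \ell_\zeta=\frac{\tau}{\zeta}-\sum_{k=1}^n\alpha_k,\quad Z=\Big\{\zeta\in\mathbb C:\Big|\Big(2\tau^{-1}\sum_{k=1}^n\alpha_k\Big)\zeta-1\Big|\le1\Big\}.$$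 **Theorem.** We have $$\{(G(0),\lambda(G))\in\mathbb C\times\mathbb R: G\in\mathrm{Gen}_\tau(F,\Lambda)\}=\{(\zeta,\omega):\zeta\in Z,\ \omega\in I_\zeta\},$$ where: (i) for $\zeta$ in the interior of $Z$, $I_\zeta=[0,\omega_\zeta]$ with $$\omega_\zeta=f\Big(\ell_\zeta+i\sum_{k=1}^n\frac{\mathrm{Im}(\overline{\sigma_k}\tau)}{|\lambda_k|}\Big),\qquad f(w)=\frac{2\,\mathrm{Re}\,w}{|w|^2+2\,\mathrm{Re}\,w\,\sum_{k=1}^n|\lambda_k|^{-1}};$$ (ii) for $\zeta\in\partial Z$, $I_\zeta=\big\{\big(\sum_{k=1}^n|\lambda_k|^{-1}\big)^{-1}\big\}$ if $1/\overline{\zeta}=\sum_{k=1}^n|\lambda_k|^{-1}(\tau-\sigma_k)$, and $I_\zeta=\{0\}$ otherwise (in particular for $\zeta=0$). Moreover, for each $\zeta$ in the interior of $Z$ there is a unique $G\in\mathrm{Gen}_\tau(F,\Lambda)$ with $G(0)=\zeta$ and $\lambda(G)=\omega_\zeta$; it is $$G(z)=\frac{(\tau-z)(1-\overline\tau z)}{\dfrac{\sigma_\zeta+z}{\sigma_\zeta-z}\,\mathrm{Re}\,\ell_\zeta+i\,\mathrm{Im}\,\ell_\zeta+p_0(z)},\qquad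 z\in\mathbb D,$$ where $\sigma_\zeta$ is the unique point of $\partial\mathbb D\setminus\{\tau\}$ for which the denominator vanishes at $z=\tau$. -/

import Mathlib

open Set Filter Topology ComplexConjugate

noncomputable section

namespace HolSemigroup

/-- The open unit disk. -/
def disk : Set ℂ := Metric.ball 0 1

/-- The Stolz region of aperture `M` in the unit disk with vertex at the boundary point `σ`. -/
def stolz (σ : ℂ) (M : ℝ) : Set ℂ := {z | z ∈ disk ∧ ‖z - σ‖ < M * (1 - ‖z‖)}

/-- `f` has the finite angular (non-tangential) limit `l` at the boundary point `σ`. -/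
def HasAngularLimit (f : ℂ → ℂ) (σ l : ℂ) : Prop :=
  ∀ M : ℝ, Tendsto f (𝓝[stolz σ M] σ) (𝓝 l)

/-- `σ` is a boundary fixed point of `φ` (in the sense of angular limits), and the angular
derivative of `φ` at `σ` exists finitely and equals `c`. -/
def HasAngularDerivAtFixed (φ : ℂ → ℂ) (σ c : ℂ) : Prop :=
  ‖σ‖ = 1 ∧ HasAngularLimit φ σ σ ∧ HasAngularLimit (fun z => (φ z - σ) / (z - σ)) σ c

/-- `σ` is a boundary regular fixed point of `φ`. -/
def IsBRFP (φ : ℂ → ℂ) (σ : ℂ) : Prop := ∃ c : ℂ, HasAngularDerivAtFixed φ σ c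

/-- `τ` is the Denjoy-Wolff point of the holomorphic self-map `φ` of the unit disk
(meant for `φ` different from the identity): either `τ` is a fixed point in the disk, or
`φ` has no fixed point in the disk and `τ` is a boundary regular fixed point at which the
angular derivative is at most `1`. -/
def IsDWPoint (φ : ℂ → ℂ) (τ : ℂ) : Prop :=
  (τ ∈ disk ∧ φ τ = τ ∧ ‖deriv φ τ‖ ≤ 1) ∨
  ((∀ z ∈ disk, φ z ≠ z) ∧ ∃ c : ℝ, c ≤ 1 ∧ HasAngularDerivAtFixed φ τ (c : ℂ))

/-- One-parameter semigroups `(φ t)`, `t ≥ 0`, of holomorphic self-maps of the unit disk.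
Only the values `φ t z` with `0 ≤ t` and `z` in the disk are meaningful. -/
structure IsOneParamSemigroup (φ : ℝ → ℂ → ℂ) : Prop where
  holo : ∀ t, 0 ≤ t → DifferentiableOn ℂ (φ t) disk
  mapsTo : ∀ t, 0 ≤ t → MapsTo (φ t) disk disk
  zero : ∀ z ∈ disk, φ 0 z = z
  add : ∀ s t, 0 ≤ s → 0 ≤ t → ∀ z ∈ disk, φ (s + t) z = φ s (φ t z)
  cont : ∀ z ∈ disk, Tendsto (fun t => φ t z) (𝓝[>] (0 : ℝ)) (𝓝 z)

/-- `G` is the infinitesimal generator of `φ`: `G` is holomorphic in the disk and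
`(d/dt) φ t z = G (φ t z)` for all `t ≥ 0` (right derivative at `t = 0`). -/
def IsGeneratorOf (G : ℂ → ℂ) (φ : ℝ → ℂ → ℂ) : Prop :=
  DifferentiableOn ℂ G disk ∧
  ∀ z ∈ disk, ∀ t : ℝ, 0 ≤ t →
    HasDerivWithinAt (fun s => φ s z) (G (φ t z)) (Ici 0) t

/-- `τ` is the Denjoy-Wolff point of every `φ t` different from the identity. The trivial
semigroup satisfies this for every `τ`. -/
def HasDWPoint (φ : ℝ → ℂ → ℂ) (τ : ℂ) : Prop :=
  ∀ t : ℝ, 0 ≤ t → ¬ EqOn (φ t) id disk → IsDWPoint (φ t) τ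

/-- `σ` is a boundary regular fixed point of the semigroup `φ` with generator `G`, and the
spectral value of the semigroup at `σ` is `μ`. -/
def HasBRFPWithSpectralValue (φ : ℝ → ℂ → ℂ) (G : ℂ → ℂ) (σ : ℂ) (μ : ℝ) : Prop :=
  (∀ t : ℝ, 0 ≤ t → IsBRFP (φ t) σ) ∧ HasAngularLimit (fun z => G z / (σ - z)) σ (μ : ℂ)

/-- The class of generators with Denjoy-Wolff point `τ` (including `G ≡ 0`), having boundary
regular fixed points `σ k` with spectral values in `[Λ k, 0]`. -/
def Gen {n : ℕ} (τ : ℂ) (σ : Fin n → ℂ) (Λ : Fin n → ℝ) : Set (ℂ → ℂ) :=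
  {G | ∃ φ : ℝ → ℂ → ℂ, IsOneParamSemigroup φ ∧ IsGeneratorOf G φ ∧ HasDWPoint φ τ ∧
    ∀ k, ∃ μ : ℝ, Λ k ≤ μ ∧ μ ≤ 0 ∧ HasBRFPWithSpectralValue φ G (σ k) μ}

/-- For `τ` on the unit circle: `ω` is the spectral value at `τ` of the semigroup generated
by `G`, that is, the angular derivative of `φ t` at `τ` is `exp (-ω t)` for all `t ≥ 0`. -/
def HasSpectralValueAt (G : ℂ → ℂ) (τ : ℂ) (ω : ℝ) : Prop :=
  ∃ φ : ℝ → ℂ → ℂ, IsOneParamSemigroup φ ∧ IsGeneratorOf G φ ∧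
    ∀ t : ℝ, 0 ≤ t → HasAngularDerivAtFixed (φ t) τ ((Real.exp (-(ω * t)) : ℝ) : ℂ)

/-- The value region of `G ↦ (G 0, λ(G))`. -/
def valueRegion {n : ℕ} (τ : ℂ) (σ : Fin n → ℂ) (Λ : Fin n → ℝ) : Set (ℂ × ℝ) :=
  {v | ∃ G ∈ Gen τ σ Λ, G 0 = v.1 ∧ HasSpectralValueAt G τ v.2}

variable {n : ℕ}

def alpha (τ : ℂ) (σ : Fin n → ℂ) (Λ : Fin n → ℝ) (k : Fin n) : ℝ :=
  ‖τ - σ k‖ ^ 2 / (2 * |Λ k|)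

def sumAlpha (τ : ℂ) (σ : Fin n → ℂ) (Λ : Fin n → ℝ) : ℝ := ∑ k, alpha τ σ Λ k

/-- `∑ 1 / |λ_k|`. -/
def sumInv (Λ : Fin n → ℝ) : ℝ := ∑ k, |Λ k|⁻¹

def p0 (τ : ℂ) (σ : Fin n → ℂ) (Λ : Fin n → ℝ) (z : ℂ) : ℂ :=
  ∑ k, (alpha τ σ Λ k : ℂ) * ((σ k + z) / (σ k - z))

def regionZ (τ : ℂ) (σ : Fin n → ℂ) (Λ : Fin n → ℝ) : Set ℂ :=
  {ζ | ‖(2 * τ⁻¹ * (sumAlpha τ σ Λ : ℂ)) * ζ - 1‖ ≤ 1}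

def ell (τ : ℂ) (σ : Fin n → ℂ) (Λ : Fin n → ℝ) (ζ : ℂ) : ℂ :=
  τ / ζ - (sumAlpha τ σ Λ : ℂ)

def fRatio (Λ : Fin n → ℝ) (w : ℂ) : ℝ :=
  2 * w.re / (‖w‖ ^ 2 + 2 * w.re * sumInv Λ)

/-- The upper end point `ω_ζ`. -/
def omegaMax (τ : ℂ) (σ : Fin n → ℂ) (Λ : Fin n → ℝ) (ζ : ℂ) : ℝ :=
  fRatio Λ (ell τ σ Λ ζ +
    Complex.I * ((∑ k, |Λ k|⁻¹ * (conj (σ k) * τ).im : ℝ) : ℂ))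

/-- The denominator of the extremal generator with parameter `s` on the unit circle. -/
def extrDenom (τ : ℂ) (σ : Fin n → ℂ) (Λ : Fin n → ℝ) (ζ s z : ℂ) : ℂ :=
  (s + z) / (s - z) * ((ell τ σ Λ ζ).re : ℂ) + Complex.I * ((ell τ σ Λ ζ).im : ℂ)
    + p0 τ σ Λ z

def extrGen (τ : ℂ) (σ : Fin n → ℂ) (Λ : Fin n → ℝ) (ζ s z : ℂ) : ℂ :=
  (τ - z) * (1 - conj τ * z) / extrDenom τ σ Λ ζ s z

end HolSemigroup

end

open HolSemigroup

noncomputable section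

namespace HolSemigroup

/-! The class is parametrised by holomorphic functions `h` with `Re h ≥ 0`. By Berkson–Porta, `G z =
(τ - z) (1 - conj τ * z) p z` with `Re p ≥ 0`. In the coordinate `herglotz τ`, which sends `τ` to
infinity in the right half-plane, the vector field becomes `2 p`. Unless `G` vanishes on the disk, a
spectral value in `[Λ k, 0]` at `σ k` means that `1 / p` has an atom of mass at least `α_k` there.
Peeling off these atoms gives `1 / p = p0 - p0 τ + h`, where `p0 τ` is imaginary. For `ζ = G 0 ≠ 0`
the value `h 0 = ell + p0 τ` is determined by `ζ`, and `Re h 0 ≥ 0` says precisely that `ζ` lies in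
`Z`.

The spectral value `ω` at `τ` is twice the largest `m` with `m * Re (herglotz τ) ≤ Re p`: one
direction is Julia's lemma for `φ t` differentiated at `t = 0`, the other is monotonicity along
trajectories. If `ω > 0`, then `1 / p` vanishes radially at `τ` with slope at most `1 / ω`. Since
`p0 - p0 τ` has slope `∑ 1 / |λ_k|`, at most `1 / ω - ∑ 1 / |λ_k|` is left for `h`. Julia's lemma
for `h` at the origin is then the bound `ω ≤ f (h 0)`. Equality forces `1 / h` to be a multiple of
`herglotz τ` plus a constant, hence uniqueness. Intermediate values come from `1 / h = m * herglotz
τ + b` with `Re b > 0`, and the value `0` from nonzero constants `h`. At nonzero points of `∂Z` one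
has `Re h 0 = 0`, so `h` is constant, and the two cases in (ii) are `h = 0` and `h ≠ 0`.

Conversely, the semigroup of an admissible `h` is built from the Koenigs function `H`, `H' = 1 / G`,
as `H⁻¹ (H + t)`; its boundary derivatives are read off from the boundary limits of `G`. -/

/-! ### The disk, the Herglotz kernel and radial approach. -/

theorem mem_disk {z : ℂ} : z ∈ disk ↔ ‖z‖ < 1 := mem_ball_zero_iff

theorem isOpen_disk : IsOpen disk := Metric.isOpen_ball

theorem convex_disk : Convex ℝ disk := convex_ball 0 1

theorem zero_mem_disk : (0 : ℂ) ∈ disk := by simp [mem_disk]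

theorem sub_ne_zero_of_mem_disk {σ z : ℂ} (hσ : ‖σ‖ = 1) (hz : z ∈ disk) : σ - z ≠ 0 := by
  intro h
  rw [sub_eq_zero] at h
  rw [mem_disk, ← h, hσ] at hz
  exact lt_irrefl _ hz

theorem conj_mul_self_of_norm_one {σ : ℂ} (hσ : ‖σ‖ = 1) : conj σ * σ = 1 := by
  rw [← Complex.normSq_eq_conj_mul_self, Complex.normSq_eq_norm_sq, hσ]; simp

theorem ne_zero_of_norm_one {σ : ℂ} (hσ : ‖σ‖ = 1) : σ ≠ 0 := by
  rintro rfl; simp at hσ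

/-- The Herglotz kernel with pole at `σ`. -/
def herglotz (σ z : ℂ) : ℂ := (σ + z) / (σ - z)

theorem herglotz_re {σ : ℂ} (hσ : ‖σ‖ = 1) (z : ℂ) :
    (herglotz σ z).re = (1 - ‖z‖ ^ 2) / ‖σ - z‖ ^ 2 := by
  have h1 : σ.re * σ.re + σ.im * σ.im = 1 := by
    rw [← Complex.normSq_apply, Complex.normSq_eq_norm_sq, hσ]; simp
  rw [herglotz, Complex.div_re, ← Complex.normSq_eq_norm_sq, ← Complex.normSq_eq_norm_sq,
    ← add_div, Complex.normSq_apply z]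
  congr 1
  simp only [Complex.add_re, Complex.sub_re, Complex.add_im, Complex.sub_im]
  linear_combination h1

theorem herglotz_re_pos {σ z : ℂ} (hσ : ‖σ‖ = 1) (hz : z ∈ disk) : 0 < (herglotz σ z).re := by
  rw [herglotz_re hσ]
  have h := norm_pos_iff.2 (sub_ne_zero_of_mem_disk hσ hz)
  have : ‖z‖ < 1 := mem_disk.1 hz
  have : 0 < 1 - ‖z‖ ^ 2 := by nlinarith [norm_nonneg z]
  positivity

theorem herglotz_zero {σ : ℂ} (hσ : ‖σ‖ = 1) : herglotz σ 0 = 1 := by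
  simp [herglotz, div_self (ne_zero_of_norm_one hσ)]

theorem differentiableOn_herglotz {σ : ℂ} (hσ : ‖σ‖ = 1) :
    DifferentiableOn ℂ (herglotz σ) disk := by
  intro z hz
  have := sub_ne_zero_of_mem_disk hσ hz
  unfold herglotz
  exact DifferentiableAt.differentiableWithinAt (by fun_prop (disch := assumption))

theorem mul_mem_disk {σ : ℂ} (hσ : ‖σ‖ = 1) {r : ℝ} (hr : r ∈ Ioo (0 : ℝ) 1) :
    (r : ℂ) * σ ∈ disk := by
  rw [mem_disk, norm_mul, hσ, mul_one, Complex.norm_real, Real.norm_of_nonneg hr.1.le]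
  exact hr.2

theorem eventually_mem_Ioo : ∀ᶠ r : ℝ in 𝓝[<] 1, r ∈ Ioo (0 : ℝ) 1 :=
  Ioo_mem_nhdsLT one_pos

theorem tendsto_radial (σ : ℂ) :
    Tendsto (fun r : ℝ => (r : ℂ) * σ) (𝓝[<] 1) (𝓝 σ) := by
  have : Continuous fun r : ℝ => (r : ℂ) * σ := by fun_prop
  have h := this.tendsto 1
  simp only [Complex.ofReal_one, one_mul] at h
  exact h.mono_left nhdsWithin_le_nhds

theorem tendsto_radial_disk {σ : ℂ} (hσ : ‖σ‖ = 1) :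
    Tendsto (fun r : ℝ => (r : ℂ) * σ) (𝓝[<] 1) (𝓝[disk] σ) :=
  tendsto_nhdsWithin_iff.2 ⟨tendsto_radial σ,
    eventually_mem_Ioo.mono fun _ hr => mul_mem_disk hσ hr⟩

theorem sub_radial (σ : ℂ) (r : ℝ) : σ - (r : ℂ) * σ = ((1 - r : ℝ) : ℂ) * σ := by
  push_cast; ring

theorem norm_sub_radial {σ : ℂ} (hσ : ‖σ‖ = 1) {r : ℝ} (hr : r ∈ Ioo (0 : ℝ) 1) :
    ‖σ - (r : ℂ) * σ‖ = 1 - r := by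
  rw [sub_radial, norm_mul, hσ, mul_one, Complex.norm_real,
    Real.norm_of_nonneg (by linarith [hr.2])]

theorem norm_radial {σ : ℂ} (hσ : ‖σ‖ = 1) {r : ℝ} (hr : r ∈ Ioo (0 : ℝ) 1) :
    ‖(r : ℂ) * σ‖ = r := by
  rw [norm_mul, hσ, mul_one, Complex.norm_real, Real.norm_of_nonneg hr.1.le]

theorem tendsto_radial_stolz {σ : ℂ} (hσ : ‖σ‖ = 1) :
    Tendsto (fun r : ℝ => (r : ℂ) * σ) (𝓝[<] 1) (𝓝[stolz σ 2] σ) := by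
  refine tendsto_nhdsWithin_iff.2 ⟨tendsto_radial σ,
    eventually_mem_Ioo.mono fun r hr => ⟨mul_mem_disk hσ hr, ?_⟩⟩
  rw [norm_sub_rev, norm_sub_radial hσ hr, norm_radial hσ hr]
  linarith [hr.2]

theorem HasAngularLimit.radial {f : ℂ → ℂ} {σ l : ℂ} (hσ : ‖σ‖ = 1) (h : HasAngularLimit f σ l) :
    Tendsto (fun r : ℝ => f ((r : ℂ) * σ)) (𝓝[<] 1) (𝓝 l) :=
  (h 2).comp (tendsto_radial_stolz hσ)

theorem hasAngularLimit_of_tendsto_disk {f : ℂ → ℂ} {σ l : ℂ} (h : Tendsto f (𝓝[disk] σ) (𝓝 l)) :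
    HasAngularLimit f σ l :=
  fun _ => h.mono_left (nhdsWithin_mono _ fun _ hz => hz.1)

theorem tendsto_one_sub_ofReal : Tendsto (fun r : ℝ => ((1 - r : ℝ) : ℂ)) (𝓝[<] 1) (𝓝 0) := by
  have : Continuous fun r : ℝ => ((1 - r : ℝ) : ℂ) := by fun_prop
  have h := this.tendsto 1
  simp only [sub_self, Complex.ofReal_zero] at h
  exact h.mono_left nhdsWithin_le_nhds

/-! ### Schwarz–Pick, Julia's lemma and atoms of functions with positive real part. -/

/-- A holomorphic function whose nonnegative real part vanishes somewhere is constant. -/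
theorem eq_of_re_eq_zero {h : ℂ → ℂ} (hd : DifferentiableOn ℂ h disk)
    (hpos : ∀ z ∈ disk, 0 ≤ (h z).re) {z₀ : ℂ} (hz₀ : z₀ ∈ disk) (h0 : (h z₀).re = 0) :
    ∀ z ∈ disk, h z = h z₀ := by
  rcases (hd.analyticOnNhd isOpen_disk).is_constant_or_isOpen convex_disk.isPreconnected with
    ⟨w, hw⟩ | ho
  · intro z hz
    rw [hw z hz, hw z₀ hz₀]
  · exfalso
    have := ho disk subset_rfl isOpen_disk
    have h2 := Complex.isOpenMap_re _ this
    have h3 : (0 : ℝ) ∈ Complex.re '' (h '' disk) := ⟨h z₀, ⟨z₀, hz₀, rfl⟩, h0⟩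
    obtain ⟨ε, hε, hb⟩ := Metric.isOpen_iff.1 h2 0 h3
    have h4 : (-(ε / 2)) ∈ Metric.ball (0 : ℝ) ε := by
      rw [mem_ball_zero_iff, norm_neg, Real.norm_of_nonneg (by positivity)]; linarith
    obtain ⟨_, ⟨z, hz, rfl⟩, hz2⟩ := hb h4
    have := hpos z hz
    linarith

theorem normSq_add_conj_sub (a b : ℂ) :
    ‖a + conj b‖ ^ 2 - ‖a - b‖ ^ 2 = 4 * a.re * b.re := by
  simp only [← Complex.normSq_eq_norm_sq, Complex.normSq_apply, Complex.add_re, Complex.sub_re,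
    Complex.add_im, Complex.sub_im, Complex.conj_re, Complex.conj_im]
  ring

theorem normSq_one_sub_conj_mul_sub (z w : ℂ) :
    ‖1 - conj w * z‖ ^ 2 - ‖z - w‖ ^ 2 = (1 - ‖z‖ ^ 2) * (1 - ‖w‖ ^ 2) := by
  simp only [← Complex.normSq_eq_norm_sq, Complex.normSq_apply, Complex.mul_re, Complex.sub_re,
    Complex.mul_im, Complex.sub_im, Complex.conj_re, Complex.conj_im, Complex.one_re,
    Complex.one_im]
  ring

theorem one_add_conj_mul_ne_zero {w z : ℂ} (hw : w ∈ disk) (hz : z ∈ disk) :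
    1 + conj w * z ≠ 0 := by
  intro h
  have h1 : ‖conj w * z‖ = 1 := by
    rw [eq_neg_of_add_eq_zero_right h]; simp
  rw [norm_mul, RCLike.norm_conj] at h1
  have := mem_disk.1 hw
  have := mem_disk.1 hz
  nlinarith [norm_nonneg w, norm_nonneg z]

theorem one_sub_conj_mul_ne_zero {w z : ℂ} (hw : w ∈ disk) (hz : z ∈ disk) :
    1 - conj w * z ≠ 0 := by
  have := one_add_conj_mul_ne_zero (w := -w) (z := z) (by simpa [mem_disk] using hw) hz
  simpa [sub_eq_add_neg] using this

/-- The Schwarz-Pick inequality for functions with positive real part. -/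
theorem schwarz_pick_re {h : ℂ → ℂ} (hd : DifferentiableOn ℂ h disk)
    (hpos : ∀ z ∈ disk, 0 < (h z).re) {z w : ℂ} (hz : z ∈ disk) (hw : w ∈ disk) :
    (1 - ‖z‖ ^ 2) * (1 - ‖w‖ ^ 2) * ‖h z + conj (h w)‖ ^ 2 ≤
      4 * (h z).re * (h w).re * ‖1 - conj w * z‖ ^ 2 := by
  -- `M` is the disk automorphism taking `0` to `w`. Following `h ∘ M` by the Cayley map of the
  -- half-plane centred at `h w` gives a self-map fixing `0`, to which Schwarz's lemma applies.
  set M : ℂ → ℂ := fun ξ => (ξ + w) / (1 + conj w * ξ) with hM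
  have hMm : MapsTo M disk disk := by
    intro ξ hξ
    have h1 := normSq_one_sub_conj_mul_sub ξ (-w)
    simp only [map_neg, neg_mul, sub_neg_eq_add, norm_neg] at h1
    have h2 := norm_pos_iff.2 (one_add_conj_mul_ne_zero hw hξ)
    have h3 : 0 < (1 - ‖ξ‖ ^ 2) * (1 - ‖w‖ ^ 2) := by
      have := mem_disk.1 hw
      have := mem_disk.1 hξ
      apply mul_pos <;> nlinarith [norm_nonneg w, norm_nonneg ξ]
    rw [mem_disk, hM, norm_div, div_lt_one h2]
    exact lt_of_pow_lt_pow_left₀ 2 h2.le (by linarith)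
  have hMd : DifferentiableOn ℂ M disk := by
    intro ξ hξ
    have := one_add_conj_mul_ne_zero hw hξ
    exact DifferentiableAt.differentiableWithinAt (by fun_prop (disch := assumption))
  have hne : ∀ ζ ∈ disk, h ζ + conj (h w) ≠ 0 := by
    intro ζ hζ h0
    have := congrArg Complex.re h0
    simp only [Complex.add_re, Complex.conj_re, Complex.zero_re] at this
    linarith [hpos ζ hζ, hpos w hw]
  set F : ℂ → ℂ := fun ξ => (h (M ξ) - h w) / (h (M ξ) + conj (h w)) with hF
  have hFd : DifferentiableOn ℂ F disk := by
    have h1 := hd.comp hMd hMm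
    exact (h1.sub_const _).div (h1.add_const _) fun ξ hξ => hne _ (hMm hξ)
  have hFm : MapsTo F (Metric.ball 0 1) (Metric.closedBall 0 1) := by
    intro ξ hξ
    have h2 := norm_pos_iff.2 (hne _ (hMm hξ))
    rw [mem_closedBall_zero_iff, hF, norm_div, div_le_one h2]
    refine le_of_sq_le_sq ?_ h2.le
    have := normSq_add_conj_sub (h (M ξ)) (h w)
    have := mul_pos (hpos _ (hMm hξ)) (hpos w hw)
    linarith
  have hF0 : F 0 = 0 := by simp [hF, hM]
  set ξ : ℂ := (z - w) / (1 - conj w * z) with hξdef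
  have hden := one_sub_conj_mul_ne_zero hw hz
  have hden' := norm_pos_iff.2 hden
  have key := normSq_one_sub_conj_mul_sub z w
  have hξ : ξ ∈ disk := by
    have h3 : 0 < (1 - ‖z‖ ^ 2) * (1 - ‖w‖ ^ 2) := by
      have := mem_disk.1 hw
      have := mem_disk.1 hz
      apply mul_pos <;> nlinarith [norm_nonneg w, norm_nonneg z]
    rw [mem_disk, hξdef, norm_div, div_lt_one hden']
    exact lt_of_pow_lt_pow_left₀ 2 hden'.le (by linarith)
  have hMξ : M ξ = z := by
    have h5 := one_add_conj_mul_ne_zero hw hξ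
    rw [hM]
    simp only
    rw [div_eq_iff h5]
    linear_combination div_mul_cancel₀ (z - w) hden
  have hS := Complex.norm_le_norm_of_mapsTo_ball hFd hFm hF0 (mem_disk.1 hξ)
  rw [hF] at hS
  simp only [hMξ] at hS
  have hp := norm_pos_iff.2 (hne z hz)
  rw [norm_div, hξdef, norm_div, div_le_div_iff₀ hp hden'] at hS
  have hsq := pow_le_pow_left₀ (by positivity) hS 2
  rw [mul_pow, mul_pow] at hsq
  have k2 := normSq_add_conj_sub (h z) (h w)
  have e1 : ‖h z - h w‖ ^ 2 = ‖h z + conj (h w)‖ ^ 2 - 4 * (h z).re * (h w).re := by linarith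
  have e2 : ‖z - w‖ ^ 2 = ‖1 - conj w * z‖ ^ 2 - (1 - ‖z‖ ^ 2) * (1 - ‖w‖ ^ 2) := by linarith
  rw [e1, e2] at hsq
  linarith

/-- Julia's lemma for a function with positive real part that vanishes radially at `τ`. -/
theorem julia_of_radial_zero {h : ℂ → ℂ} {τ : ℂ} (hτ : ‖τ‖ = 1) (hd : DifferentiableOn ℂ h disk)
    (hpos : ∀ z ∈ disk, 0 < (h z).re)
    (h0 : Tendsto (fun r : ℝ => h (r * τ)) (𝓝[<] 1) (𝓝 0)) {e : ℝ → ℝ} {D : ℝ}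
    (he : Tendsto e (𝓝[<] 1) (𝓝 D)) (hle : ∀ᶠ r : ℝ in 𝓝[<] 1, (h (r * τ)).re ≤ e r * (1 - r))
    {z : ℂ} (hz : z ∈ disk) : ‖h z‖ ^ 2 * (herglotz τ z).re ≤ 2 * D * (h z).re := by
  have hzp := hpos z hz
  have hid : Tendsto (fun r : ℝ => r) (𝓝[<] 1) (𝓝 1) := nhdsWithin_le_nhds
  have hL : Tendsto (fun r : ℝ => (1 - ‖z‖ ^ 2) * (1 + r) * ‖h z + conj (h (r * τ))‖ ^ 2)
      (𝓝[<] 1) (𝓝 ((1 - ‖z‖ ^ 2) * (1 + 1) * ‖h z + conj 0‖ ^ 2)) :=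
    ((hid.const_add 1).const_mul _).mul
      ((tendsto_const_nhds.add ((Complex.continuous_conj.tendsto 0).comp h0)).norm.pow 2)
  have hR : Tendsto (fun r : ℝ => 4 * (h z).re * e r * ‖1 - conj ((r : ℂ) * τ) * z‖ ^ 2)
      (𝓝[<] 1) (𝓝 (4 * (h z).re * D * ‖1 - conj τ * z‖ ^ 2)) :=
    (he.const_mul _).mul
      ((tendsto_const_nhds.sub
        (((Complex.continuous_conj.tendsto τ).comp (tendsto_radial τ)).mul_const z)).norm.pow 2)
  -- Schwarz–Pick for the pair `z`, `r * τ`: the factor `1 - r` of `1 - r ^ 2` cancels against the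
  -- bound `e r * (1 - r)`, and then `r → 1`.
  have hkey := le_of_tendsto_of_tendsto hL hR (by
    filter_upwards [hle, eventually_mem_Ioo] with r hr1 hr2
    have hp := schwarz_pick_re hd hpos hz (mul_mem_disk hτ hr2)
    rw [norm_radial hτ hr2] at hp
    have h1r : 0 < 1 - r := by linarith [hr2.2]
    refine le_of_mul_le_mul_right ?_ h1r
    calc (1 - ‖z‖ ^ 2) * (1 + r) * ‖h z + conj (h (r * τ))‖ ^ 2 * (1 - r)
        = (1 - ‖z‖ ^ 2) * (1 - r ^ 2) * ‖h z + conj (h (r * τ))‖ ^ 2 := by ring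
      _ ≤ 4 * (h z).re * (h (r * τ)).re * ‖1 - conj ((r : ℂ) * τ) * z‖ ^ 2 := hp
      _ ≤ 4 * (h z).re * (e r * (1 - r)) * ‖1 - conj ((r : ℂ) * τ) * z‖ ^ 2 := by gcongr
      _ = _ := by ring)
  simp only [map_zero, add_zero] at hkey
  have hn : ‖1 - conj τ * z‖ = ‖τ - z‖ := by
    have : 1 - conj τ * z = conj τ * (τ - z) := by
      rw [mul_sub, conj_mul_self_of_norm_one hτ]
    rw [this, norm_mul, RCLike.norm_conj, hτ, one_mul]
  rw [hn] at hkey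
  have hq := norm_pos_iff.2 (sub_ne_zero_of_mem_disk hτ hz)
  rw [herglotz_re hτ, ← mul_div_assoc, div_le_iff₀ (by positivity)]
  linarith

theorem re_inv_eq (w : ℂ) : (w⁻¹).re = w.re / ‖w‖ ^ 2 := by
  rw [Complex.inv_re, Complex.normSq_eq_norm_sq]

/-- A holomorphic function with nonnegative real part dominates the Poisson kernels of the
atoms of its Herglotz measure. -/
theorem mul_herglotz_le_of_radial {q : ℂ → ℂ} {σ : ℂ} (hσ : ‖σ‖ = 1)
    (hd : DifferentiableOn ℂ q disk) (hpos : ∀ z ∈ disk, 0 ≤ (q z).re) {m : ℝ} (hm : 0 ≤ m)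
    (hlim : Tendsto (fun r : ℝ => ((1 - r : ℝ) : ℂ) * q (r * σ)) (𝓝[<] 1) (𝓝 ((2 * m : ℝ) : ℂ)))
    {z : ℂ} (hz : z ∈ disk) : m * (herglotz σ z).re ≤ (q z).re := by
  rcases hm.eq_or_lt with rfl | hm
  · simpa using hpos z hz
  have hone := tendsto_one_sub_ofReal
  have hm2 : ((2 * m : ℝ) : ℂ) ≠ 0 := by
    rw [Ne, Complex.ofReal_eq_zero]; positivity
  have hpos' : ∀ z ∈ disk, 0 < (q z).re := by
    intro w hw
    refine lt_of_le_of_ne (hpos w hw) fun h0 => ?_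
    have hc := eq_of_re_eq_zero hd hpos hw h0.symm
    have h2 : Tendsto (fun r : ℝ => ((1 - r : ℝ) : ℂ) * q (r * σ)) (𝓝[<] 1) (𝓝 (0 * q w)) := by
      refine (hone.mul_const (q w)).congr' ?_
      filter_upwards [eventually_mem_Ioo] with r hr
      rw [hc _ (mul_mem_disk hσ hr)]
    rw [zero_mul] at h2
    exact hm2 (tendsto_nhds_unique hlim h2)
  have hne : ∀ z ∈ disk, q z ≠ 0 := fun z hz h0 => by
    have := hpos' z hz
    simp [h0] at this
  have hr : ∀ z ∈ disk, 0 < ((q z)⁻¹).re := fun z hz => by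
    rw [re_inv_eq]
    have := norm_pos_iff.2 (hne z hz)
    have := hpos' z hz
    positivity
  have hlim2 := (hlim.inv₀ hm2)
  have hlim3 : Tendsto (fun r : ℝ => (((1 - r : ℝ) : ℂ) * q (r * σ))⁻¹.re) (𝓝[<] 1)
      (𝓝 (((2 * m : ℝ) : ℂ)⁻¹.re)) := (Complex.continuous_re.tendsto _).comp hlim2
  -- An atom of `q` at `σ` is a zero of `1 / q` with radial slope `1 / (2 * m)`, so Julia's lemma
  -- applies to `1 / q`.
  have hJ := julia_of_radial_zero hσ (h := fun z => (q z)⁻¹) (hd.inv hne) hr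
    (by
      have := hone.mul hlim2
      rw [zero_mul] at this
      refine this.congr' ?_
      filter_upwards [eventually_mem_Ioo] with r hr
      have : ((1 - r : ℝ) : ℂ) ≠ 0 := by
        rw [Ne, Complex.ofReal_eq_zero]; linarith [hr.2]
      rw [mul_inv, mul_inv_cancel_left₀ this]) hlim3
    (by
      filter_upwards [eventually_mem_Ioo] with r hr
      have h1 : 0 < 1 - r := by linarith [hr.2]
      rw [mul_inv, ← Complex.ofReal_inv, Complex.re_ofReal_mul]
      apply le_of_eq
      field_simp) hz
  have hzp := norm_pos_iff.2 (hne z hz)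
  rw [← Complex.ofReal_inv, Complex.ofReal_re, re_inv_eq, norm_inv] at hJ
  field_simp at hJ
  linarith

/-- Atoms are peeled off one at a time. The kernels already subtracted stay bounded near the next
point, as the points are distinct, so they do not disturb its limit; the remainder keeps a
nonnegative real part. -/
theorem sum_mul_herglotz_le_of_radial {ι : Type*} {q : ℂ → ℂ} {σ : ι → ℂ} {m : ι → ℝ}
    (hσ : ∀ k, ‖σ k‖ = 1) (hinj : Function.Injective σ)
    (hd : DifferentiableOn ℂ q disk) (hpos : ∀ z ∈ disk, 0 ≤ (q z).re) (hm : ∀ k, 0 ≤ m k)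
    (hlim : ∀ k, Tendsto (fun r : ℝ => ((1 - r : ℝ) : ℂ) * q (r * σ k)) (𝓝[<] 1)
      (𝓝 ((2 * m k : ℝ) : ℂ))) (s : Finset ι) :
    ∀ z ∈ disk, 0 ≤ (q z - ∑ k ∈ s, (m k : ℂ) * herglotz (σ k) z).re := by
  classical
  induction s using Finset.induction_on with
  | empty => simpa using hpos
  | insert a s ha ih =>
    intro z hz
    have hone := tendsto_one_sub_ofReal
    have hsum : Tendsto (fun r : ℝ => ((1 - r : ℝ) : ℂ) *
        ∑ k ∈ s, (m k : ℂ) * herglotz (σ k) (r * σ a)) (𝓝[<] 1) (𝓝 0) := by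
      have h1 : Tendsto (fun r : ℝ => ∑ k ∈ s, (m k : ℂ) * herglotz (σ k) (r * σ a)) (𝓝[<] 1)
          (𝓝 (∑ k ∈ s, (m k : ℂ) * ((σ k + σ a) / (σ k - σ a)))) := by
        refine tendsto_finsetSum _ fun k hk => Tendsto.const_mul _ ?_
        have hne : σ k - σ a ≠ 0 := by
          rw [sub_ne_zero]
          exact fun h => ha (hinj h ▸ hk)
        exact ((tendsto_radial (σ a)).const_add _).div ((tendsto_radial (σ a)).const_sub _) hne
      simpa using hone.mul h1
    have hdiff : DifferentiableOn ℂ (fun z => q z - ∑ k ∈ s, (m k : ℂ) * herglotz (σ k) z) disk := by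
      refine hd.sub (DifferentiableOn.fun_sum fun k _ => ?_)
      exact (differentiableOn_herglotz (hσ k)).const_mul _
    have := mul_herglotz_le_of_radial (hσ a) hdiff ih (hm a) (by
      have := (hlim a).sub hsum
      rw [sub_zero] at this
      simpa only [mul_sub] using this) hz
    rw [Finset.sum_insert ha]
    simp only [Complex.sub_re, Complex.add_re, Complex.re_ofReal_mul] at this ⊢
    linarith

theorem add_ne_zero_of_mem_disk {σ z : ℂ} (hσ : ‖σ‖ = 1) (hz : z ∈ disk) : σ + z ≠ 0 := by
  have := sub_ne_zero_of_mem_disk (z := -z) hσ (by simpa [mem_disk] using hz)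
  simpa using this

/-! ### Angular derivatives at boundary fixed points. -/

/-- Julia's lemma at a boundary regular fixed point. -/
theorem julia_of_angularDeriv {φ : ℂ → ℂ} {τ : ℂ} {c : ℝ} (hd : DifferentiableOn ℂ φ disk)
    (hm : MapsTo φ disk disk) (h : HasAngularDerivAtFixed φ τ c) :
    0 < c ∧ ∀ z ∈ disk, (herglotz τ z).re ≤ c * (herglotz τ (φ z)).re := by
  obtain ⟨hτ, h1, h2⟩ := h
  have hτ0 := ne_zero_of_norm_one hτ
  have hr1 := h1.radial hτ
  have hr2 := h2.radial hτ
  have hinv : ∀ z ∈ disk, (τ - φ z) / (τ + φ z) = (herglotz τ (φ z))⁻¹ := fun z _ => by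
    rw [herglotz, inv_div]
  have hne : ∀ z ∈ disk, herglotz τ (φ z) ≠ 0 := fun z hz h0 => by
    have := herglotz_re_pos hτ (hm hz)
    simp [h0] at this
  have hle : ∀ z ∈ disk, (herglotz τ z).re ≤ c * (herglotz τ (φ z)).re := by
    intro z hz
    have hadd : Tendsto (fun r : ℝ => τ + φ (r * τ)) (𝓝[<] 1) (𝓝 (τ + τ)) := hr1.const_add τ
    have hττ : τ + τ ≠ 0 := by simpa [← two_mul] using hτ0
    -- The reciprocal of `herglotz τ ∘ φ` vanishes radially at `τ` with slope `c / 2`.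
    have hJ := julia_of_radial_zero hτ (h := fun z => (τ - φ z) / (τ + φ z))
      ((hd.const_sub τ).div (hd.const_add τ) fun z hz => add_ne_zero_of_mem_disk hτ (hm hz))
      (fun z hz => by
        rw [hinv z hz, re_inv_eq]
        have := norm_pos_iff.2 (hne z hz)
        have := herglotz_re_pos hτ (hm hz)
        positivity)
      (by
        have := (hr1.const_sub τ).div hadd hττ
        rw [sub_self, zero_div] at this
        exact this)
      (D := c / 2)
      (e := fun r => ((φ (r * τ) - τ) / (r * τ - τ) * (τ / (τ + φ (r * τ)))).re)
      (by
        have h3 := hr2.mul ((tendsto_const_nhds (x := τ)).div hadd hττ)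
        have h4 := (Complex.continuous_re.tendsto _).comp h3
        have h5 : ((c : ℂ) * (τ / (τ + τ))).re = c / 2 := by
          have : τ / (τ + τ) = ((1 / 2 : ℝ) : ℂ) := by
            push_cast; field_simp; ring
          rw [this, Complex.re_ofReal_mul, Complex.ofReal_re]; ring
        rw [h5] at h4
        exact h4)
      (by
        filter_upwards [eventually_mem_Ioo] with r hr
        have h1r : ((1 - r : ℝ) : ℂ) ≠ 0 := by
          rw [Ne, Complex.ofReal_eq_zero]; linarith [hr.2]
        have hp := add_ne_zero_of_mem_disk hτ (hm (mul_mem_disk hτ hr))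
        rw [mul_comm _ (1 - r), ← Complex.re_ofReal_mul]
        apply le_of_eq
        congr 1
        have : (r : ℂ) * τ - τ = -(((1 - r : ℝ) : ℂ) * τ) := by push_cast; ring
        rw [this]
        field_simp
        ring) hz
    simp only [hinv z hz] at hJ
    have hp := norm_pos_iff.2 (hne z hz)
    rw [norm_inv, re_inv_eq] at hJ
    field_simp at hJ
    linarith
  refine ⟨?_, hle⟩
  have h0 := hle 0 zero_mem_disk
  rw [herglotz_zero hτ, Complex.one_re] at h0
  have := herglotz_re_pos hτ (hm zero_mem_disk)
  by_contra hc
  nlinarith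

theorem norm_angularDeriv_radial {φ : ℂ → ℂ} {τ : ℂ} {c : ℝ} (hc : 0 ≤ c)
    (h : HasAngularDerivAtFixed φ τ c) :
    Tendsto (fun r : ℝ => ‖τ - φ (r * τ)‖ / (1 - r)) (𝓝[<] 1) (𝓝 c) := by
  have h2 := (h.2.2.radial h.1).norm
  rw [Complex.norm_real, Real.norm_of_nonneg hc] at h2
  refine h2.congr' ?_
  filter_upwards [eventually_mem_Ioo] with r hr
  rw [norm_div, norm_sub_rev, norm_sub_rev (r * τ), norm_sub_radial h.1 hr]

theorem one_sub_norm_le {τ : ℂ} (hτ : ‖τ‖ = 1) (w : ℂ) : 1 - ‖w‖ ≤ ‖τ - w‖ := by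
  have := norm_sub_norm_le τ w
  rwa [hτ] at this

theorem herglotz_radial {τ : ℂ} (hτ : ‖τ‖ = 1) {r : ℝ} (hr : r ∈ Ioo (0 : ℝ) 1) :
    (herglotz τ (r * τ)).re = (1 + r) / (1 - r) := by
  have : 1 - r ≠ 0 := by linarith [hr.2]
  rw [herglotz_re hτ, norm_radial hτ hr, norm_sub_radial hτ hr]
  field_simp
  ring

/-- With Julia's lemma this makes the angular derivative the least constant in Julia's inequality.
It suffices to compare along the radius, where `1 - ‖w‖ ^ 2 ≤ 2 * ‖τ - w‖` with `w = φ (r * τ)`. -/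
theorem angularDeriv_le {φ : ℂ → ℂ} {τ : ℂ} {c K : ℝ} (hm : MapsTo φ disk disk) (hc : 0 ≤ c)
    (h : HasAngularDerivAtFixed φ τ c)
    (hK : ∀ z ∈ disk, (herglotz τ z).re ≤ K * (herglotz τ (φ z)).re) : c ≤ K := by
  have hτ := h.1
  have hid : Tendsto (fun r : ℝ => r) (𝓝[<] 1) (𝓝 1) := nhdsWithin_le_nhds
  have h1 := (hid.const_add 1).mul (norm_angularDeriv_radial hc h)
  have hK0 : 0 < K := by
    have h0 := hK 0 zero_mem_disk
    rw [herglotz_zero hτ, Complex.one_re] at h0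
    have := herglotz_re_pos hτ (hm zero_mem_disk)
    by_contra hc
    nlinarith
  have h2 := le_of_tendsto h1 (b := 2 * K) (by
    filter_upwards [eventually_mem_Ioo] with r hr
    have hz := mul_mem_disk hτ hr
    have h3 := hK _ hz
    have h1r : 0 < 1 - r := by linarith [hr.2]
    rw [herglotz_radial hτ hr, herglotz_re hτ] at h3
    set w := φ (r * τ)
    have hw : ‖w‖ < 1 := mem_disk.1 (hm hz)
    have hp : 0 < ‖τ - w‖ := norm_pos_iff.2 (sub_ne_zero_of_mem_disk hτ (hm hz))
    have h4 : 1 - ‖w‖ ^ 2 ≤ 2 * ‖τ - w‖ := by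
      nlinarith [one_sub_norm_le hτ w, norm_nonneg w]
    have h5 : (1 + r) / (1 - r) ≤ K * (2 / ‖τ - w‖) := by
      refine h3.trans ?_
      refine mul_le_mul_of_nonneg_left ?_ hK0.le
      rw [div_le_div_iff₀ (by positivity) hp]
      nlinarith
    have h6 := mul_le_mul_of_nonneg_right h5 hp.le
    calc (1 + r) * (‖τ - w‖ / (1 - r)) = (1 + r) / (1 - r) * ‖τ - w‖ := by ring
      _ ≤ K * (2 / ‖τ - w‖) * ‖τ - w‖ := h6
      _ = 2 * K := by field_simp)
  linarith

/-- The chain rule for angular derivatives at a common boundary fixed point. -/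
theorem angularDeriv_comp {φ ψ χ : ℂ → ℂ} {τ : ℂ} {a b c : ℝ}
    (hφ : DifferentiableOn ℂ φ disk) (hm : MapsTo φ disk disk)
    (ha : HasAngularDerivAtFixed φ τ a) (hb : HasAngularDerivAtFixed ψ τ b)
    (hc : HasAngularDerivAtFixed χ τ c) (hχ : ∀ z ∈ disk, χ z = ψ (φ z)) : c = b * a := by
  have hτ := ha.1
  obtain ⟨ha0, hJ⟩ := julia_of_angularDeriv hφ hm ha
  have hn := norm_angularDeriv_radial ha0.le ha
  -- The image of the radius must approach `τ` non-tangentially for the angular limit of `ψ` to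
  -- apply. Julia's inequality and the slope bound `‖τ - w‖ > (a / 2) * (1 - r)` give `‖τ - w‖ ≤ 4 *
  -- (1 - ‖w‖)`; the aperture taken is a generous one.
  have hst : Tendsto (fun r : ℝ => φ (r * τ)) (𝓝[<] 1) (𝓝[stolz τ (4 * a / (a / 2) + 1)] τ) := by
    refine tendsto_nhdsWithin_iff.2 ⟨ha.2.1.radial hτ, ?_⟩
    filter_upwards [eventually_mem_Ioo, hn.eventually (lt_mem_nhds (half_lt_self ha0))] with r hr hr2
    have hz := mul_mem_disk hτ hr
    refine ⟨hm hz, ?_⟩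
    have h3 := hJ _ hz
    have h1r : 0 < 1 - r := by linarith [hr.2]
    rw [herglotz_radial hτ hr, herglotz_re hτ] at h3
    rw [norm_sub_rev]
    set w := φ (r * τ)
    have hw : ‖w‖ < 1 := mem_disk.1 (hm hz)
    have hp := norm_pos_iff.2 (sub_ne_zero_of_mem_disk hτ (hm hz))
    rw [lt_div_iff₀ h1r] at hr2
    rw [← mul_div_assoc, div_le_div_iff₀ h1r (by positivity)] at h3
    have h4 : 1 - ‖w‖ ^ 2 ≤ 2 * (1 - ‖w‖) := by nlinarith [norm_nonneg w]
    have h5 : ‖τ - w‖ * (a / 2) ≤ 2 * a * (1 - ‖w‖) := by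
      refine le_of_mul_le_mul_right ?_ (mul_pos hp h1r)
      calc ‖τ - w‖ * (a / 2) * (‖τ - w‖ * (1 - r)) = ‖τ - w‖ ^ 2 * (a / 2 * (1 - r)) := by ring
        _ ≤ ‖τ - w‖ ^ 2 * ‖τ - w‖ := by gcongr
        _ ≤ (1 + r) * ‖τ - w‖ ^ 2 * ‖τ - w‖ := by
          have : 0 ≤ r * (‖τ - w‖ ^ 2 * ‖τ - w‖) := mul_nonneg hr.1.le (by positivity)
          linarith
        _ ≤ a * (1 - ‖w‖ ^ 2) * (1 - r) * ‖τ - w‖ := by gcongr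
        _ ≤ a * (2 * (1 - ‖w‖)) * (1 - r) * ‖τ - w‖ := by gcongr
        _ = _ := by ring
    have h6 : ‖τ - w‖ ≤ 2 * a * (1 - ‖w‖) / (a / 2) := by rwa [le_div_iff₀ (by positivity)]
    have h7 : 0 ≤ 2 * a * (1 - ‖w‖) / (a / 2) := le_trans hp.le h6
    calc ‖τ - w‖ ≤ 2 * a * (1 - ‖w‖) / (a / 2) := h6
      _ < 2 * (2 * a * (1 - ‖w‖) / (a / 2)) + (1 - ‖w‖) := by linarith
      _ = _ := by ring
  have h1 := ((hb.2.2 _).comp hst).mul (ha.2.2.radial hτ)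
  have h2 := hc.2.2.radial hτ
  have h3 : (c : ℂ) = b * a := by
    refine tendsto_nhds_unique h2 (h1.congr' ?_)
    filter_upwards [eventually_mem_Ioo] with r hr
    have hz := mul_mem_disk hτ hr
    have hne := sub_ne_zero_of_mem_disk hτ (hm hz)
    have hne2 : φ (r * τ) - τ ≠ 0 := by rwa [← neg_sub, neg_ne_zero]
    rw [hχ _ hz]
    simp only [Function.comp]
    field_simp
  exact_mod_cast h3

/-- `-log c` is additive and nonnegative, hence monotone, and a monotone additive function is
linear. No continuity in `t` is required. -/
theorem exists_exp_of_multiplicative {c : ℝ → ℝ} (hpos : ∀ t, 0 ≤ t → 0 < c t)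
    (hle : ∀ t, 0 ≤ t → c t ≤ 1) (hmul : ∀ s t, 0 ≤ s → 0 ≤ t → c (s + t) = c s * c t) :
    ∃ ω : ℝ, 0 ≤ ω ∧ ∀ t, 0 ≤ t → c t = Real.exp (-(ω * t)) := by
  set f : ℝ → ℝ := fun t => -Real.log (c t) with hf
  have hf0 : ∀ t, 0 ≤ t → 0 ≤ f t := fun t ht =>
    neg_nonneg.2 (Real.log_nonpos (hpos t ht).le (hle t ht))
  have hadd : ∀ s t, 0 ≤ s → 0 ≤ t → f (s + t) = f s + f t := fun s t hs ht => by
    simp only [hf, hmul s t hs ht, Real.log_mul (hpos s hs).ne' (hpos t ht).ne']; ring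
  have hmono : ∀ s t, 0 ≤ s → s ≤ t → f s ≤ f t := fun s t hs hst => by
    have := hadd s (t - s) hs (by linarith)
    rw [add_sub_cancel] at this
    linarith [hf0 (t - s) (by linarith)]
  have hnat : ∀ (n : ℕ) t, 0 ≤ t → f (n * t) = n * f t := fun n t ht => by
    induction n with
    | zero =>
      have := hadd 0 0 le_rfl le_rfl
      simp only [add_zero] at this
      simp only [Nat.cast_zero, zero_mul]
      linarith
    | succ n ih =>
      push_cast
      rw [add_mul, one_mul, hadd _ _ (by positivity) ht, ih]; ring
  have hlin : ∀ t, 0 ≤ t → f t = f 1 * t := by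
    intro t ht
    -- Both `f (N * t)` and `N * t * f 1` lie between `k * f 1` and `(k + 1) * f 1` for `k = ⌊N *
    -- t⌋`.
    have hb : ∀ N : ℕ, |f t - f 1 * t| * N ≤ f 1 := by
      intro N
      set k := ⌊(N : ℝ) * t⌋₊
      have hNt : 0 ≤ (N : ℝ) * t := by positivity
      have h1 : (k : ℝ) ≤ N * t := Nat.floor_le hNt
      have h2 : (N : ℝ) * t < k + 1 := Nat.lt_floor_add_one _
      have h3 := hmono _ _ (by positivity) h1
      have h4 := hmono _ _ hNt h2.le
      have h5 := hnat k 1 zero_le_one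
      have h6 := hnat (k + 1) 1 zero_le_one
      have h7 := hnat N t ht
      push_cast at h6
      rw [mul_one] at h5 h6
      have h8 := hf0 1 zero_le_one
      rw [← abs_of_nonneg (Nat.cast_nonneg (α := ℝ) N), ← abs_mul, abs_le]
      constructor <;> nlinarith
    by_contra hne
    have hp : 0 < |f t - f 1 * t| := abs_pos.2 (sub_ne_zero.2 hne)
    obtain ⟨N, hN⟩ := exists_nat_gt (f 1 / |f t - f 1 * t|)
    rw [div_lt_iff₀ hp] at hN
    linarith [hb N]
  refine ⟨f 1, hf0 1 zero_le_one, fun t ht => ?_⟩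
  rw [← hlin t ht, hf]
  simp only [neg_neg, Real.exp_log (hpos t ht)]

/-! ### The Berkson–Porta function and the spectral value at `τ`. -/

/-- The function `p` in the Berkson-Porta formula `G z = (τ - z) (1 - conj τ * z) p z`. -/
def berksonPorta (τ : ℂ) (G : ℂ → ℂ) (z : ℂ) : ℂ := G z / ((τ - z) * (1 - conj τ * z))

theorem one_sub_conj_mul_eq {τ : ℂ} (hτ : ‖τ‖ = 1) (z : ℂ) :
    1 - conj τ * z = conj τ * (τ - z) := by
  rw [mul_sub, conj_mul_self_of_norm_one hτ]

theorem conj_ne_zero_of_norm_one {τ : ℂ} (hτ : ‖τ‖ = 1) : conj τ ≠ 0 := by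
  simpa using ne_zero_of_norm_one hτ

theorem porta_factor_ne_zero {τ z : ℂ} (hτ : ‖τ‖ = 1) (hz : z ∈ disk) :
    (τ - z) * (1 - conj τ * z) ≠ 0 := by
  have := sub_ne_zero_of_mem_disk hτ hz
  rw [one_sub_conj_mul_eq hτ]
  exact mul_ne_zero this (mul_ne_zero (conj_ne_zero_of_norm_one hτ) this)

theorem hasDerivAt_herglotz {τ z : ℂ} (hz : τ - z ≠ 0) :
    HasDerivAt (herglotz τ) (2 * τ / (τ - z) ^ 2) z := by
  have h := ((hasDerivAt_id z).const_add τ).div ((hasDerivAt_id z).const_sub τ) hz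
  refine h.congr_deriv ?_
  congr 1
  simp only [id]
  ring

/-- In the half-plane coordinate `herglotz τ` the flow has velocity `2 p`, because the derivative `2
τ / (τ - z) ^ 2` cancels the Berkson–Porta factor. -/
theorem hasDerivWithinAt_herglotz_flow {φ : ℝ → ℂ → ℂ} {G : ℂ → ℂ} {τ : ℂ} (hτ : ‖τ‖ = 1)
    {z : ℂ} {t : ℝ} (hz : φ t z ∈ disk)
    (hG : HasDerivWithinAt (fun s => φ s z) (G (φ t z)) (Ici 0) t) :
    HasDerivWithinAt (fun s => (herglotz τ (φ s z)).re)
      (2 * (berksonPorta τ G (φ t z)).re) (Ici 0) t := by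
  have hne := sub_ne_zero_of_mem_disk hτ hz
  have h1 := (hasDerivAt_herglotz hne).comp_hasDerivWithinAt t hG
  have h2 := (Complex.reCLM.hasFDerivAt (x := herglotz τ (φ t z))).comp_hasDerivWithinAt t h1
  refine h2.congr_deriv ?_
  simp only [Complex.reCLM_apply]
  rw [← Complex.re_ofReal_mul]
  congr 1
  rw [berksonPorta, one_sub_conj_mul_eq hτ]
  have := conj_ne_zero_of_norm_one hτ
  have h3 := conj_mul_self_of_norm_one hτ
  push_cast
  field_simp
  linear_combination G (φ t z) * h3

/-- By Julia's lemma `exp (-ω t) * Re (herglotz τ (φ t z))` is never below its value at `t = 0`, so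
its right derivative there is nonnegative. -/
theorem mul_herglotz_le_berksonPorta {G : ℂ → ℂ} {τ : ℂ} {ω : ℝ} (h : HasSpectralValueAt G τ ω) :
    ∀ z ∈ disk, ω * (herglotz τ z).re ≤ 2 * (berksonPorta τ G z).re := by
  obtain ⟨φ, hφ, hG, hc⟩ := h
  intro z hz
  have hτ := (hc 0 le_rfl).1
  have h0 : φ 0 z = z := hφ.zero z hz
  have h1 := hasDerivWithinAt_herglotz_flow hτ (t := 0) (by rwa [h0]) (hG.2 z hz 0 le_rfl)
  have h2 : HasDerivWithinAt (fun t : ℝ => Real.exp (-(ω * t))) (-ω) (Ici 0) 0 := by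
    have := (((hasDerivAt_id (0 : ℝ)).const_mul ω).neg.exp).hasDerivWithinAt (s := Ici 0)
    simpa using this
  have h3 := h2.mul h1
  rw [h0] at h3
  have h4 : 0 ≤ -ω * (herglotz τ z).re + Real.exp (-(ω * 0)) * (2 * (berksonPorta τ G z).re) := by
    have hs := hasDerivWithinAt_iff_tendsto_slope.1 h3
    have hs' := hs.mono_left (nhdsWithin_mono 0 (show Ioi (0 : ℝ) ⊆ Ici 0 \ {0} from
      fun x hx => ⟨mem_Ici.2 (le_of_lt hx), ne_of_gt hx⟩))
    refine ge_of_tendsto hs' ?_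
    filter_upwards [self_mem_nhdsWithin] with t ht
    have ht' : 0 ≤ t := le_of_lt ht
    have hj := (julia_of_angularDeriv (hφ.holo t ht') (hφ.mapsTo t ht') (hc t ht')).2 z hz
    rw [slope_def_field]
    refine div_nonneg ?_ (by simpa using ht')
    simp only [Pi.mul_apply, h0]
    simpa using hj
  simp only [mul_zero, neg_zero, Real.exp_zero, one_mul] at h4
  linarith

/-- The right side is nondecreasing in `t`: its derivative is a positive multiple of `Re p - m * Re
(herglotz τ)` at `φ t z`. -/
theorem exp_mul_herglotz_le_flow {φ : ℝ → ℂ → ℂ} {G : ℂ → ℂ} {τ : ℂ} (hτ : ‖τ‖ = 1) {m : ℝ}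
    {z : ℂ} (hφ : ∀ t, 0 ≤ t → φ t z ∈ disk) (h0 : φ 0 z = z)
    (hG : ∀ t, 0 ≤ t → HasDerivWithinAt (fun s => φ s z) (G (φ t z)) (Ici 0) t)
    (hm : ∀ z ∈ disk, m * (herglotz τ z).re ≤ (berksonPorta τ G z).re) {t : ℝ} (ht : 0 ≤ t) :
    (herglotz τ z).re ≤ Real.exp (-(2 * m * t)) * (herglotz τ (φ t z)).re := by
  have hd : ∀ t : ℝ, 0 ≤ t → HasDerivWithinAt
      (fun t => Real.exp (-(2 * m * t)) * (herglotz τ (φ t z)).re)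
      (Real.exp (-(2 * m * t)) * (-(2 * m)) * (herglotz τ (φ t z)).re +
        Real.exp (-(2 * m * t)) * (2 * (berksonPorta τ G (φ t z)).re)) (Ici 0) t := by
    intro t ht
    have h2 : HasDerivWithinAt (fun t : ℝ => Real.exp (-(2 * m * t)))
        (Real.exp (-(2 * m * t)) * (-(2 * m))) (Ici 0) t := by
      have := (((hasDerivAt_id t).const_mul (2 * m)).neg.exp).hasDerivWithinAt (s := Ici 0)
      simpa using this
    exact h2.mul (hasDerivWithinAt_herglotz_flow hτ (hφ t ht) (hG t ht))
  have hmono : MonotoneOn (fun t => Real.exp (-(2 * m * t)) * (herglotz τ (φ t z)).re)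
      (Ici 0) := by
    refine monotoneOn_of_hasDerivWithinAt_nonneg (convex_Ici 0)
      (fun t ht => (hd t ht).continuousWithinAt)
      (fun t ht => (hd t (interior_subset ht)).mono interior_subset) fun t ht => ?_
    have := hm _ (hφ t (interior_subset ht))
    have he := (Real.exp_pos (-(2 * m * t))).le
    nlinarith [mul_le_mul_of_nonneg_left this he]
  have := hmono (mem_Ici.2 le_rfl) (mem_Ici.2 ht) ht
  simpa [h0] using this

theorem two_mul_le_spectralValue {G : ℂ → ℂ} {τ : ℂ} {ω m : ℝ} (h : HasSpectralValueAt G τ ω)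
    (hm : ∀ z ∈ disk, m * (herglotz τ z).re ≤ (berksonPorta τ G z).re) : 2 * m ≤ ω := by
  obtain ⟨φ, hφ, hG, hc⟩ := h
  have h1 := hc 1 zero_le_one
  have := angularDeriv_le (hφ.mapsTo 1 zero_le_one) (Real.exp_pos _).le h1 fun z hz =>
    exp_mul_herglotz_le_flow h1.1 (fun t ht => hφ.mapsTo t ht hz) (hφ.zero z hz)
      (hG.2 z hz) hm zero_le_one
  rw [Real.exp_le_exp] at this
  linarith

/-- `ω / 2` is the largest admissible `m` in the preceding bounds, a quantity that depends on `G`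
alone; uniqueness of the semigroup is not needed. -/
theorem spectralValue_unique {G : ℂ → ℂ} {τ : ℂ} {ω ω' : ℝ} (h : HasSpectralValueAt G τ ω)
    (h' : HasSpectralValueAt G τ ω') : ω = ω' := by
  have key : ∀ {a b : ℝ}, HasSpectralValueAt G τ a → HasSpectralValueAt G τ b → a ≤ b := by
    intro a b ha hb
    have := two_mul_le_spectralValue (m := a / 2) hb fun z hz => by
      linarith [mul_herglotz_le_berksonPorta ha z hz]
    linarith
  exact le_antisymm (key h h') (key h' h)

variable {n : ℕ}

/-- The Denjoy–Wolff condition gives derivatives at most `1` (equal to `1` when `φ t` is the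
identity), and the chain rule makes them multiplicative in `t`. -/
theorem exists_spectralValue {τ : ℂ} {σ : Fin n → ℂ} {Λ : Fin n → ℝ} (hτ : ‖τ‖ = 1) {G : ℂ → ℂ}
    (hG : G ∈ Gen τ σ Λ) : ∃ ω : ℝ, 0 ≤ ω ∧ HasSpectralValueAt G τ ω := by
  obtain ⟨φ, hφ, hgen, hdw, -⟩ := hG
  have hex : ∀ t, 0 ≤ t → ∃ c : ℝ, c ≤ 1 ∧ HasAngularDerivAtFixed (φ t) τ (c : ℂ) := by
    intro t ht
    by_cases hid : EqOn (φ t) id disk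
    · refine ⟨1, le_rfl, hτ, ?_, ?_⟩
      · refine hasAngularLimit_of_tendsto_disk ?_
        refine (tendsto_id.mono_left nhdsWithin_le_nhds).congr' ?_
        filter_upwards [self_mem_nhdsWithin] with z hz
        rw [hid hz]
      · refine hasAngularLimit_of_tendsto_disk ?_
        refine tendsto_const_nhds.congr' ?_
        filter_upwards [self_mem_nhdsWithin] with z hz
        have := sub_ne_zero_of_mem_disk hτ hz
        rw [hid hz, id, div_self (by rwa [← neg_sub, neg_ne_zero]), Complex.ofReal_one]
    · rcases hdw t ht hid with ⟨h1, -⟩ | ⟨-, h⟩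
      · rw [mem_disk, hτ] at h1
        exact absurd h1 (lt_irrefl _)
      · exact h
  choose! c hc1 hc using hex
  obtain ⟨ω, hω, hωc⟩ := exists_exp_of_multiplicative (c := c)
    (fun t ht => (julia_of_angularDeriv (hφ.holo t ht) (hφ.mapsTo t ht) (hc t ht)).1) hc1
    fun s t hs ht => angularDeriv_comp (hφ.holo t ht) (hφ.mapsTo t ht) (hc t ht) (hc s hs)
      (hc _ (add_nonneg hs ht)) (hφ.add s t hs ht)
  exact ⟨ω, hω, φ, hφ, hgen, fun t ht => hωc t ht ▸ hc t ht⟩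

theorem berksonPorta_re_nonneg {τ : ℂ} {σ : Fin n → ℂ} {Λ : Fin n → ℝ} (hτ : ‖τ‖ = 1) {G : ℂ → ℂ}
    (hG : G ∈ Gen τ σ Λ) : ∀ z ∈ disk, 0 ≤ (berksonPorta τ G z).re := by
  obtain ⟨ω, hω, h⟩ := exists_spectralValue hτ hG
  intro z hz
  have := mul_herglotz_le_berksonPorta h z hz
  have := mul_nonneg hω (herglotz_re_pos hτ hz).le
  linarith

theorem differentiableOn_berksonPorta {τ : ℂ} (hτ : ‖τ‖ = 1) {G : ℂ → ℂ}
    (hG : DifferentiableOn ℂ G disk) : DifferentiableOn ℂ (berksonPorta τ G) disk := by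
  refine hG.div (by fun_prop) fun z hz => porta_factor_ne_zero hτ hz

/-! ### Behaviour at the prescribed fixed points. -/

theorem porta_factor_eq {τ σ : ℂ} (hσ : ‖σ‖ = 1) :
    (τ - σ) * (1 - conj τ * σ) = -(σ * ((‖τ - σ‖ ^ 2 : ℝ) : ℂ)) := by
  rw [← Complex.normSq_eq_norm_sq, ← Complex.mul_conj, map_sub]
  linear_combination (σ - τ) * conj_mul_self_of_norm_one hσ

theorem berksonPorta_radial {τ σ : ℂ} (hσ : ‖σ‖ = 1) (hne : τ ≠ σ) {G : ℂ → ℂ}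
    {μ : ℝ} (h : HasAngularLimit (fun z => G z / (σ - z)) σ μ) :
    Tendsto (fun r : ℝ => berksonPorta τ G (r * σ) / ((1 - r : ℝ) : ℂ)) (𝓝[<] 1)
      (𝓝 ((-μ / ‖τ - σ‖ ^ 2 : ℝ) : ℂ)) := by
  have hσ0 := ne_zero_of_norm_one hσ
  have hf : (τ - σ) * (1 - conj τ * σ) ≠ 0 := by
    have := norm_pos_iff.2 (sub_ne_zero.2 hne)
    rw [porta_factor_eq hσ, neg_ne_zero]
    exact mul_ne_zero hσ0 (Complex.ofReal_ne_zero.2 (by positivity))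
  have h1 := ((h.radial hσ).mul_const σ).div
    (((tendsto_radial σ).const_sub τ).mul (((tendsto_radial σ).const_mul (conj τ)).const_sub 1)) hf
  have h2 : (μ : ℂ) * σ / ((τ - σ) * (1 - conj τ * σ)) = ((-μ / ‖τ - σ‖ ^ 2 : ℝ) : ℂ) := by
    have := Complex.ofReal_ne_zero.2 (norm_pos_iff.2 (sub_ne_zero.2 hne)).ne'
    rw [porta_factor_eq hσ]
    push_cast
    field_simp
  rw [h2] at h1
  refine h1.congr' ?_
  filter_upwards [eventually_mem_Ioo] with r hr
  have h1r : ((1 - r : ℝ) : ℂ) ≠ 0 := by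
    rw [Ne, Complex.ofReal_eq_zero]; linarith [hr.2]
  simp only [Pi.div_apply]
  rw [berksonPorta, sub_radial]
  field_simp

/-- If `Re p` vanishes somewhere, `p` is constant; its radial limit at any one `σ k` is `0`, and `1
≤ n` supplies such a point. -/
theorem eq_zero_or_berksonPorta_re_pos {τ : ℂ} {σ : Fin n → ℂ} {Λ : Fin n → ℝ} (hn : 1 ≤ n)
    (hτ : ‖τ‖ = 1) (hσ : ∀ k, ‖σ k‖ = 1) (hτσ : ∀ k, τ ≠ σ k) {G : ℂ → ℂ} (hG : G ∈ Gen τ σ Λ) :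
    (∀ z ∈ disk, G z = 0) ∨ ∀ z ∈ disk, 0 < (berksonPorta τ G z).re := by
  have hpos := berksonPorta_re_nonneg hτ hG
  obtain ⟨φ, hφ, hgen, hdw, hk⟩ := hG
  by_cases hall : ∀ z ∈ disk, 0 < (berksonPorta τ G z).re
  · exact Or.inr hall
  left
  push Not at hall
  obtain ⟨z₀, hz₀, h0⟩ := hall
  have hc := eq_of_re_eq_zero (differentiableOn_berksonPorta hτ hgen.1) hpos hz₀
    (le_antisymm h0 (hpos z₀ hz₀))
  let k : Fin n := ⟨0, hn⟩
  obtain ⟨μ, -, -, -, hμ⟩ := hk k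
  have h1 := (berksonPorta_radial (hσ k) (hτσ k) hμ).mul tendsto_one_sub_ofReal
  rw [mul_zero] at h1
  have h2 : berksonPorta τ G z₀ = 0 := by
    refine tendsto_nhds_unique tendsto_const_nhds (h1.congr' ?_)
    filter_upwards [eventually_mem_Ioo] with r hr
    have h1r : ((1 - r : ℝ) : ℂ) ≠ 0 := by
      rw [Ne, Complex.ofReal_eq_zero]; linarith [hr.2]
    rw [div_mul_cancel₀ _ h1r, hc _ (mul_mem_disk (hσ k) hr)]
  intro z hz
  have h3 := hc z hz
  rw [h2, berksonPorta, div_eq_zero_iff] at h3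
  exact h3.resolve_right (porta_factor_ne_zero hτ hz)

theorem p0_eq (τ : ℂ) (σ : Fin n → ℂ) (Λ : Fin n → ℝ) (z : ℂ) :
    p0 τ σ Λ z = ∑ k, (alpha τ σ Λ k : ℂ) * herglotz (σ k) z := rfl

/-- The atoms of the reciprocal of the Berkson-Porta function at the prescribed boundary fixed
points are bounded below. -/
theorem p0_re_le_inv_berksonPorta {τ : ℂ} {σ : Fin n → ℂ} {Λ : Fin n → ℝ}
    (hτ : ‖τ‖ = 1) (hσ : ∀ k, ‖σ k‖ = 1) (hinj : Function.Injective σ) (hτσ : ∀ k, τ ≠ σ k)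
    {G : ℂ → ℂ} (hG : G ∈ Gen τ σ Λ)
    (hpos : ∀ z ∈ disk, 0 < (berksonPorta τ G z).re) :
    ∀ z ∈ disk, (p0 τ σ Λ z).re ≤ ((berksonPorta τ G z)⁻¹).re := by
  obtain ⟨φ, hφ, hgen, hdw, hk⟩ := hG
  choose μ hμ1 hμ2 hμ3 using hk
  have hd := differentiableOn_berksonPorta hτ hgen.1
  have hne : ∀ z ∈ disk, berksonPorta τ G z ≠ 0 := fun z hz h0 => by
    have := hpos z hz
    simp [h0] at this
  have hdist : ∀ k, 0 < ‖τ - σ k‖ := fun k => norm_pos_iff.2 (sub_ne_zero.2 (hτσ k))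
  -- With spectral value `0`, Julia's inequality at the origin would force `p 0 = 0`.
  have hμneg : ∀ k, μ k < 0 := by
    intro k
    have hrad := berksonPorta_radial (hσ k) (hτσ k) (hμ3 k).2
    have hJ := julia_of_radial_zero (hσ k) hd hpos (by
        have h1 := hrad.mul tendsto_one_sub_ofReal
        rw [mul_zero] at h1
        refine h1.congr' ?_
        filter_upwards [eventually_mem_Ioo] with r hr
        have h1r : ((1 - r : ℝ) : ℂ) ≠ 0 := by
          rw [Ne, Complex.ofReal_eq_zero]; linarith [hr.2]
        rw [div_mul_cancel₀ _ h1r])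
      ((Complex.continuous_re.tendsto _).comp hrad) (by
        filter_upwards [eventually_mem_Ioo] with r hr
        have h1 : 0 < 1 - r := by linarith [hr.2]
        rw [Function.comp, Complex.div_ofReal_re, div_mul_cancel₀ _ h1.ne']) zero_mem_disk
    rw [herglotz_zero (hσ k), Complex.one_re, mul_one, Complex.ofReal_re] at hJ
    have h2 := norm_pos_iff.2 (hne 0 zero_mem_disk)
    have h3 := hpos 0 zero_mem_disk
    refine lt_of_le_of_ne (hμ2 k) fun h0 => ?_
    rw [h0] at hJ
    simp only [neg_zero, zero_div, mul_zero, zero_mul] at hJ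
    nlinarith
  -- The mass of the atom of `1 / p` at `σ k` is half the reciprocal of the slope of `p` there; it
  -- is at least `α_k` since `|μ k| ≤ |Λ k|`.
  have hmain := sum_mul_herglotz_le_of_radial (q := fun z => (berksonPorta τ G z)⁻¹)
    (m := fun k => ‖τ - σ k‖ ^ 2 / (2 * -μ k)) hσ hinj (hd.inv hne)
    (fun z hz => by
      rw [re_inv_eq]
      have := hpos z hz
      positivity)
    (fun k => by
      have := hμneg k
      have : 0 < -μ k := by linarith
      positivity)
    (fun k => by
      have h1 := hμneg k
      have h2 := (hdist k).ne'
      have h4 : -μ k ≠ 0 := by linarith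
      have hrad := (berksonPorta_radial (hσ k) (hτσ k) (hμ3 k).2).inv₀ (by
        rw [Ne, Complex.ofReal_eq_zero]
        exact div_ne_zero h4 (pow_ne_zero 2 h2))
      rw [← Complex.ofReal_inv] at hrad
      have h3 : (-μ k / ‖τ - σ k‖ ^ 2)⁻¹ = 2 * (‖τ - σ k‖ ^ 2 / (2 * -μ k)) := by
        have h5 : μ k ≠ 0 := h1.ne
        field_simp
      rw [h3] at hrad
      refine hrad.congr fun r => ?_
      rw [inv_div, div_eq_mul_inv]) Finset.univ
  intro z hz
  have h1 := hmain z hz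
  rw [p0_eq]
  simp only [Complex.sub_re, Complex.re_sum, Complex.re_ofReal_mul] at h1 ⊢
  refine le_trans (Finset.sum_le_sum fun k _ => ?_) (sub_nonneg.1 h1)
  refine mul_le_mul_of_nonneg_right ?_ (herglotz_re_pos (hσ k) hz).le
  have := hμneg k
  have h2 := hμ1 k
  rw [alpha, abs_of_neg (by linarith)]
  gcongr
  linarith

/-! ### Construction of the semigroup through the Koenigs function. -/

/-- The inverse of `herglotz τ`, from the right half-plane to the disk. -/
def cayleyInv (τ u : ℂ) : ℂ := τ * ((u - 1) / (u + 1))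

theorem add_one_ne_zero_of_re_pos {u : ℂ} (hu : 0 < u.re) : u + 1 ≠ 0 := by
  intro h
  have := congrArg Complex.re h
  simp only [Complex.add_re, Complex.one_re, Complex.zero_re] at this
  linarith

theorem cayleyInv_mem_disk {τ u : ℂ} (hτ : ‖τ‖ = 1) (hu : 0 < u.re) : cayleyInv τ u ∈ disk := by
  have h1 := norm_pos_iff.2 (add_one_ne_zero_of_re_pos hu)
  rw [mem_disk, cayleyInv, norm_mul, hτ, one_mul, norm_div, div_lt_one h1]
  refine lt_of_pow_lt_pow_left₀ 2 h1.le ?_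
  have := normSq_add_conj_sub u 1
  simp only [map_one, Complex.one_re] at this
  linarith

theorem cayleyInv_herglotz {τ z : ℂ} (hτ : ‖τ‖ = 1) (hz : z ∈ disk) :
    cayleyInv τ (herglotz τ z) = z := by
  have h1 := sub_ne_zero_of_mem_disk hτ hz
  have h2 := ne_zero_of_norm_one hτ
  have h3 := add_one_ne_zero_of_re_pos (herglotz_re_pos hτ hz)
  rw [cayleyInv, ← mul_div_assoc, div_eq_iff h3, herglotz]
  field_simp
  ring

theorem hasDerivAt_cayleyInv {τ u : ℂ} (hu : u + 1 ≠ 0) :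
    HasDerivAt (cayleyInv τ) (2 * τ / (u + 1) ^ 2) u := by
  have h := (((hasDerivAt_id u).sub_const 1).div ((hasDerivAt_id u).add_const 1) hu).const_mul τ
  refine h.congr_deriv ?_
  simp only [id]
  field_simp
  ring

/-- The Koenigs function of a generator is injective. -/
theorem injOn_of_hasDerivAt_inv_generator {G H : ℂ → ℂ} {τ : ℂ} (hτ : ‖τ‖ = 1)
    (hpos : ∀ z ∈ disk, 0 < (berksonPorta τ G z).re)
    (hH : ∀ z ∈ disk, HasDerivAt H (G z)⁻¹ z) : InjOn H disk := by
  intro z₁ h₁ z₂ h₂ heq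
  by_contra hne
  set a := herglotz τ z₁
  set b := herglotz τ z₂
  have hab : b - a ≠ 0 := by
    intro h
    apply hne
    rw [← cayleyInv_herglotz hτ h₁, ← cayleyInv_herglotz hτ h₂]
    exact congrArg _ (sub_eq_zero.1 h).symm
  have ha := herglotz_re_pos hτ h₁
  have hb := herglotz_re_pos hτ h₂
  -- Noshiro–Warschawski argument: in the half-plane coordinate `H` has derivative `1 / (2 p)`, of
  -- positive real part, so it is injective along each segment.
  set u : ℝ → ℂ := fun s => a + s * (b - a) with hu
  have hure : ∀ s ∈ Icc (0 : ℝ) 1, 0 < (u s).re := by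
    intro s hs
    have : (u s).re = (1 - s) * a.re + s * b.re := by
      simp only [hu, Complex.add_re, Complex.re_ofReal_mul, Complex.sub_re]; ring
    rw [this]
    rcases hs.1.eq_or_lt with h0 | h0
    · rw [← h0]; simpa using ha
    · have := mul_nonneg (sub_nonneg.2 hs.2) ha.le
      have := mul_pos h0 hb
      linarith
  have hderiv : ∀ s ∈ Icc (0 : ℝ) 1,
      HasDerivAt (fun s : ℝ => (H (cayleyInv τ (u s)) / (b - a)).re)
        ((2 * berksonPorta τ G (cayleyInv τ (u s)))⁻¹).re s := by
    intro s hs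
    have hs' := hure s hs
    have hu1 := add_one_ne_zero_of_re_pos hs'
    have hm := cayleyInv_mem_disk hτ hs'
    have h1 : HasDerivAt (fun x : ℂ => a + x * (b - a)) (b - a) (s : ℂ) := by
      simpa using ((hasDerivAt_id (s : ℂ)).mul_const (b - a)).const_add a
    have h2 := (hasDerivAt_cayleyInv (τ := τ) hu1).comp (s : ℂ) h1
    have h3 := ((hH _ hm).comp (s : ℂ) h2).div_const (b - a)
    have h4 := h3.real_of_complex
    refine h4.congr_deriv ?_
    congr 1
    have hτ0 := ne_zero_of_norm_one hτ
    have hsub : τ - cayleyInv τ (u s) = 2 * τ / (u s + 1) := by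
      rw [cayleyInv]; field_simp; ring
    have hp : G (cayleyInv τ (u s)) = (4 * τ / (u s + 1) ^ 2) *
        berksonPorta τ G (cayleyInv τ (u s)) := by
      have hf := porta_factor_ne_zero hτ hm
      have h5 : 4 * τ / (u s + 1) ^ 2 =
          (τ - cayleyInv τ (u s)) * (1 - conj τ * cayleyInv τ (u s)) := by
        rw [one_sub_conj_mul_eq hτ, hsub]
        field_simp
        linear_combination -4 * conj_mul_self_of_norm_one hτ
      rw [berksonPorta, h5, mul_div_cancel₀ _ hf]
    rw [hp]
    have h6 : berksonPorta τ G (cayleyInv τ (u s)) ≠ 0 := fun h0 => by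
      have := hpos _ hm
      simp [h0] at this
    field_simp
    ring
  have hmono := strictMonoOn_of_hasDerivWithinAt_pos (convex_Icc (0 : ℝ) 1)
    (fun s hs => (hderiv s hs).continuousAt.continuousWithinAt)
    (fun s hs => (hderiv s (interior_subset hs)).hasDerivWithinAt) fun s hs => by
      have h1 := hpos _ (cayleyInv_mem_disk hτ (hure s (interior_subset hs)))
      have h2 : 0 < (2 * berksonPorta τ G (cayleyInv τ (u s))).re := by
        have := Complex.re_ofReal_mul 2 (berksonPorta τ G (cayleyInv τ (u s)))
        push_cast at this
        rw [this]; positivity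
      have h3 : 2 * berksonPorta τ G (cayleyInv τ (u s)) ≠ 0 := fun h0 => by
        simp [h0] at h2
      rw [re_inv_eq]
      have := norm_pos_iff.2 h3
      positivity
  have h01 := hmono (left_mem_Icc.2 zero_le_one) (right_mem_Icc.2 zero_le_one) zero_lt_one
  have hu0 : u 0 = a := by simp [hu]
  have hu1 : u 1 = b := by simp [hu]
  simp only [hu0, hu1] at h01
  rw [cayleyInv_herglotz hτ h₁, cayleyInv_herglotz hτ h₂, heq] at h01
  exact lt_irrefl _ h01

/-- The closed horodisk meets the unit circle only at `τ`, so away from `τ` it is compact inside the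
disk and `G` is bounded there. -/
theorem horodisk_bound {G : ℂ → ℂ} {τ : ℂ} (hG : ContinuousOn G disk) {C a : ℝ} (ha : 0 < a)
    (hC : ∀ᶠ z in 𝓝[disk] τ, ‖G z‖ ≤ C * ‖τ - z‖) :
    ∃ K : ℝ, ∀ z ∈ disk, a * ‖τ - z‖ ^ 2 ≤ 1 - ‖z‖ ^ 2 → ‖G z‖ ≤ K * ‖τ - z‖ := by
  obtain ⟨δ, hδ, hb⟩ := Metric.eventually_nhds_iff.1 (eventually_nhdsWithin_iff.1 hC)
  set S : Set ℂ := Metric.closedBall 0 1 ∩ {z | a * ‖τ - z‖ ^ 2 ≤ 1 - ‖z‖ ^ 2 ∧ δ ≤ ‖τ - z‖}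
  have hS : IsCompact S := by
    refine (isCompact_closedBall 0 1).inter_right ?_
    exact (isClosed_le (f := fun z : ℂ => a * ‖τ - z‖ ^ 2) (g := fun z => 1 - ‖z‖ ^ 2)
      (by fun_prop) (by fun_prop)).inter
      (isClosed_le (f := fun _ => δ) (g := fun z : ℂ => ‖τ - z‖) (by fun_prop) (by fun_prop))
  have hSd : S ⊆ disk := by
    rintro z ⟨-, hz1, hz2⟩
    have h1 : 0 < a * ‖τ - z‖ ^ 2 := by
      have : 0 < ‖τ - z‖ := lt_of_lt_of_le hδ hz2
      positivity
    rw [mem_disk]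
    nlinarith [norm_nonneg z]
  obtain ⟨M, hM⟩ := hS.exists_bound_of_continuousOn (hG.mono hSd)
  refine ⟨max C (M / δ), fun z hz hza => ?_⟩
  by_cases hzδ : ‖τ - z‖ < δ
  · refine (hb (by rwa [dist_comm, dist_eq_norm]) hz).trans ?_
    gcongr
    exact le_max_left _ _
  · push Not at hzδ
    have h1 := hM z ⟨mem_closedBall_zero_iff.2 (mem_disk.1 hz).le, hza, hzδ⟩
    have hM0 : 0 ≤ M := (norm_nonneg _).trans h1
    calc ‖G z‖ ≤ M := h1
      _ = M / δ * δ := by field_simp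
      _ ≤ M / δ * ‖τ - z‖ := by gcongr
      _ ≤ _ := by gcongr; exact le_max_right _ _

/-- Existence of the semigroup generated by a function of Berkson-Porta type whose growth at the
boundary point `τ` is at most linear. -/
theorem exists_semigroup {G : ℂ → ℂ} {τ : ℂ} (hτ : ‖τ‖ = 1) (hG : DifferentiableOn ℂ G disk)
    (hpos : ∀ z ∈ disk, 0 < (berksonPorta τ G z).re) {C : ℝ}
    (hC : ∀ᶠ z in 𝓝[disk] τ, ‖G z‖ ≤ C * ‖τ - z‖) :
    ∃ φ : ℝ → ℂ → ℂ, IsOneParamSemigroup φ ∧ IsGeneratorOf G φ ∧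
      ∀ t : ℝ, 0 < t → ∀ z ∈ disk, φ t z ≠ z := by
  have hG0 : ∀ z ∈ disk, G z ≠ 0 := fun z hz h0 => by
    have := hpos z hz
    simp [berksonPorta, h0] at this
  obtain ⟨H, hH⟩ : ∃ H : ℂ → ℂ, ∀ z ∈ disk, HasDerivAt H (G z)⁻¹ z :=
    DifferentiableOn.isExactOn_ball (hG.inv hG0)
  have hHd : DifferentiableOn ℂ H disk := fun z hz =>
    (hH z hz).differentiableAt.differentiableWithinAt
  have hinj := injOn_of_hasDerivAt_inv_generator hτ hpos hH
  have hopen : ∀ s ⊆ disk, IsOpen s → IsOpen (H '' s) := by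
    refine ((hHd.analyticOnNhd isOpen_disk).is_constant_or_isOpen
      convex_disk.isPreconnected).resolve_left ?_
    rintro ⟨w, hw⟩
    have h1 : (1 / 2 : ℂ) ∈ disk := by rw [mem_disk]; norm_num
    have := hinj h1 zero_mem_disk ((hw _ h1).trans (hw _ zero_mem_disk).symm)
    norm_num at this
  set V := H '' disk with hV
  have hVo : IsOpen V := hopen disk subset_rfl isOpen_disk
  set g : ℂ → ℂ := Function.invFunOn H disk with hg
  have hgm : ∀ w ∈ V, g w ∈ disk := fun w hw => Function.invFunOn_mem hw
  have hHg : ∀ w ∈ V, H (g w) = w := fun w hw => Function.invFunOn_eq hw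
  have hgH : ∀ z ∈ disk, g (H z) = z := fun z hz =>
    hinj (hgm _ ⟨z, hz, rfl⟩) hz (hHg _ ⟨z, hz, rfl⟩)
  have hgd : ∀ w ∈ V, HasDerivAt g (G (g w)) w := by
    intro w hw
    have hc : ContinuousAt g w := by
      rw [ContinuousAt, tendsto_def]
      intro U hU
      obtain ⟨O, hO1, hO2, hO3⟩ := mem_nhds_iff.1 (inter_mem hU (isOpen_disk.mem_nhds (hgm w hw)))
      refine mem_of_superset ((hopen O (fun z hz => (hO1 hz).2) hO2).mem_nhds
        ⟨g w, hO3, hHg w hw⟩) ?_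
      rintro _ ⟨z, hz, rfl⟩
      rw [mem_preimage, hgH z (hO1 hz).2]
      exact (hO1 hz).1
    have := HasDerivAt.of_local_left_inverse hc (hH _ (hgm w hw)) (inv_ne_zero (hG0 _ (hgm w hw)))
      ((hVo.eventually_mem hw).mono hHg)
    rwa [inv_inv] at this
  have hpath : ∀ z (t : ℝ), H z + t ∈ V →
      HasDerivAt (fun s : ℝ => g (H z + s)) (G (g (H z + t))) t := by
    intro z t ht
    have h1 : HasDerivAt (fun s : ℂ => H z + s) 1 (t : ℂ) := (hasDerivAt_id _).const_add _
    have h2 := ((hgd _ ht).comp (t : ℂ) h1).comp_ofReal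
    simpa using h2
  -- Global existence is the invariance of the image of `H` under positive translations. A first
  -- exit time `T` is shown to be impossible.
  have hstay : ∀ z ∈ disk, ∀ t : ℝ, 0 ≤ t → H z + t ∈ V := by
    intro z hz
    by_contra! hcon
    set B : Set ℝ := {t | 0 ≤ t ∧ H z + t ∉ V} with hB
    have hBne : B.Nonempty := hcon
    have hBbdd : BddBelow B := ⟨0, fun t ht => ht.1⟩
    have hBc : IsClosed B := by
      refine isClosed_Ici.inter ?_
      exact (hVo.preimage (f := fun t : ℝ => H z + (t : ℂ)) (by fun_prop)).isClosed_compl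
    set T := sInf B
    have hT : T ∈ B := hBc.csInf_mem hBne hBbdd
    have hbefore : ∀ s, 0 ≤ s → s < T → H z + s ∈ V := by
      intro s hs hsT
      by_contra hsV
      exact absurd (csInf_le hBbdd (show s ∈ B from ⟨hs, hsV⟩)) (not_le.2 hsT)
    have hT0 : 0 < T := by
      refine lt_of_le_of_ne hT.1 fun h0 => hT.2 ?_
      rw [← h0]
      exact ⟨z, hz, by simp⟩
    set u : ℝ → ℂ := fun s => g (H z + s) with hu
    have hud : ∀ s ∈ Ico 0 T, HasDerivAt u (G (u s)) s := fun s hs =>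
      hpath z s (hbefore s hs.1 hs.2)
    have hum : ∀ s ∈ Ico 0 T, u s ∈ disk := fun s hs => hgm _ (hbefore s hs.1 hs.2)
    have hu0 : u 0 = z := by simp [hu, hgH z hz]
    set a := (herglotz τ z).re
    have ha : 0 < a := herglotz_re_pos hτ hz
    -- The trajectory stays in the horodisk at `τ` through its starting point.
    have hmono : MonotoneOn (fun s => (herglotz τ (u s)).re) (Ico 0 T) := by
      have hd : ∀ s ∈ Ico 0 T, HasDerivWithinAt (fun s => (herglotz τ (u s)).re)
          (2 * (berksonPorta τ G (u s)).re) (Ici 0) s := fun s hs =>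
        hasDerivWithinAt_herglotz_flow (φ := fun s _ => u s) (z := 0) hτ (hum s hs)
          (hud s hs).hasDerivWithinAt
      refine monotoneOn_of_hasDerivWithinAt_nonneg (convex_Ico 0 T)
        (fun s hs => ((hd s hs).mono Ico_subset_Ici_self).continuousWithinAt)
        (fun s hs => (hd s (interior_subset hs)).mono
          (interior_subset.trans Ico_subset_Ici_self)) fun s hs => ?_
      have := hpos _ (hum s (interior_subset hs))
      positivity
    have hhoro : ∀ s ∈ Ico 0 T, a * ‖τ - u s‖ ^ 2 ≤ 1 - ‖u s‖ ^ 2 := by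
      intro s hs
      have h1 := hmono (left_mem_Ico.2 hT0) hs hs.1
      simp only [hu0] at h1
      rw [herglotz_re hτ (u s)] at h1
      have := norm_pos_iff.2 (sub_ne_zero_of_mem_disk hτ (hum s hs))
      rwa [le_div_iff₀ (by positivity)] at h1
    obtain ⟨K, hK⟩ := horodisk_bound hG.continuousOn ha hC
    -- Gronwall for `1 / (τ - u)`: with growth of `G` at most linear in `‖τ - u‖`, the trajectory
    -- cannot reach `τ` in finite time.
    have hlow : ∀ s ∈ Ico 0 T, ‖(τ - u s)⁻¹‖ ≤ ‖(τ - z)⁻¹‖ * Real.exp (|K| * T) := by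
      intro s hs
      have hsub : ∀ x ∈ Icc 0 s, x ∈ Ico 0 T := fun x hx => ⟨hx.1, hx.2.trans_lt hs.2⟩
      have hd : ∀ x ∈ Icc 0 s, HasDerivAt (fun x => (τ - u x)⁻¹) (G (u x) / (τ - u x) ^ 2) x := by
        intro x hx
        have := ((hud x (hsub x hx)).const_sub τ).inv
          (sub_ne_zero_of_mem_disk hτ (hum x (hsub x hx)))
        rw [neg_neg] at this
        exact this
      have := norm_le_gronwallBound_of_norm_deriv_right_le (K := K) (ε := 0)
        (δ := ‖(τ - z)⁻¹‖)
        (fun x hx => (hd x hx).continuousAt.continuousWithinAt)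
        (fun x hx => (hd x (Ico_subset_Icc_self hx)).hasDerivWithinAt) (by rw [hu0])
        (fun x hx => by
          have hx' := hsub x (Ico_subset_Icc_self hx)
          have h1 := hK _ (hum x hx') (hhoro x hx')
          have h2 := norm_pos_iff.2 (sub_ne_zero_of_mem_disk hτ (hum x hx'))
          rw [add_zero, norm_div, norm_pow, norm_inv, div_le_iff₀ (by positivity)]
          calc ‖G (u x)‖ ≤ K * ‖τ - u x‖ := h1
            _ = _ := by field_simp) s (right_mem_Icc.2 hs.1)
      rw [gronwallBound_ε0, sub_zero] at this
      refine this.trans ?_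
      gcongr
      · exact hs.1
      · exact le_abs_self K
      · exact hs.2.le
    have hev : ∀ᶠ s in 𝓝[<] T, s ∈ Ico 0 T :=
      mem_of_superset (Ioo_mem_nhdsLT hT0) Ioo_subset_Ico_self
    -- A cluster point suffices: it lies in the disk, and continuity of `H` gives `H y = H z + T`,
    -- contrary to the choice of `T`.
    obtain ⟨y, hy1, hy2⟩ := (isCompact_closedBall (0 : ℂ) 1).exists_mapClusterPt_of_frequently
      (l := 𝓝[<] T) (f := u) (hev.frequently.mono fun s hs =>
        mem_closedBall_zero_iff.2 (mem_disk.1 (hum s hs)).le)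
    set m := ‖(τ - z)⁻¹‖ * Real.exp (|K| * T) with hm
    have hmpos : 0 < m := by
      have := norm_pos_iff.2 (inv_ne_zero (sub_ne_zero_of_mem_disk hτ hz))
      positivity
    have hyS : y ∈ {w : ℂ | a * ‖τ - w‖ ^ 2 ≤ 1 - ‖w‖ ^ 2 ∧ m⁻¹ ≤ ‖τ - w‖} := by
      have hcl : IsClosed {w : ℂ | a * ‖τ - w‖ ^ 2 ≤ 1 - ‖w‖ ^ 2 ∧ m⁻¹ ≤ ‖τ - w‖} :=
        (isClosed_le (f := fun w : ℂ => a * ‖τ - w‖ ^ 2) (g := fun w => 1 - ‖w‖ ^ 2)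
          (by fun_prop) (by fun_prop)).inter
          (isClosed_le (f := fun _ => m⁻¹) (g := fun w : ℂ => ‖τ - w‖) (by fun_prop) (by fun_prop))
      refine hcl.mem_of_mapClusterPt hy2 (hev.mono fun s hs => ⟨hhoro s hs, ?_⟩)
      have h1 := hlow s hs
      have h2 := norm_pos_iff.2 (sub_ne_zero_of_mem_disk hτ (hum s hs))
      rw [norm_inv] at h1
      exact (inv_le_comm₀ h2 hmpos).1 h1
    have hyd : y ∈ disk := by
      have h1 : 0 < ‖τ - y‖ := lt_of_lt_of_le (inv_pos.2 hmpos) hyS.2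
      have h2 : 0 < a * ‖τ - y‖ ^ 2 := by positivity
      have h3 := hyS.1
      rw [mem_disk]
      nlinarith [norm_nonneg y]
    have hHy : H y = H z + T := by
      have h1 : MapClusterPt (H y) (𝓝[<] T) (H ∘ u) :=
        hy2.continuousAt_comp (hH y hyd).continuousAt
      have h2 : Tendsto (H ∘ u) (𝓝[<] T) (𝓝 (H z + T)) := by
        have h3 : Tendsto (fun s : ℝ => H z + (s : ℂ)) (𝓝[<] T) (𝓝 (H z + T)) := by
          have : Continuous fun s : ℝ => H z + (s : ℂ) := by fun_prop
          exact (this.tendsto T).mono_left nhdsWithin_le_nhds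
        refine h3.congr' (hev.mono fun s hs => ?_)
        exact (hHg _ (hbefore s hs.1 hs.2)).symm
      exact eq_of_nhds_neBot (ClusterPt.mono h1 h2)
    exact hT.2 ⟨y, hyd, hHy⟩
  refine ⟨fun t z => g (H z + t), ⟨?_, ?_, ?_, ?_, ?_⟩, ⟨hG, ?_⟩, ?_⟩
  · intro t ht z hz
    have h1 : HasDerivAt (fun z => H z + (t : ℂ)) (G z)⁻¹ z := (hH z hz).add_const _
    exact ((hgd _ (hstay z hz t ht)).comp z h1).differentiableAt.differentiableWithinAt
  · exact fun t ht z hz => hgm _ (hstay z hz t ht)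
  · intro z hz
    simp [hgH z hz]
  · intro s t hs ht z hz
    rw [hHg _ (hstay z hz t ht)]
    push_cast
    congr 1
    ring
  · intro z hz
    have h1 := (hpath z 0 (hstay z hz 0 le_rfl)).continuousAt.tendsto
    simp only [Complex.ofReal_zero, add_zero, hgH z hz] at h1
    exact h1.mono_left nhdsWithin_le_nhds
  · exact fun z hz t ht => (hpath z t (hstay z hz t ht)).hasDerivWithinAt
  · intro t ht z hz h0
    have h1 := hHg _ (hstay z hz t ht.le)
    simp only at h0
    rw [h0] at h1
    have : (t : ℂ) = 0 := by linear_combination -h1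
    rw [Complex.ofReal_eq_zero] at this
    exact ht.ne' this

/-! ### From boundary limits of the generator to membership in the class. -/

/-- A boundary point at which the generator has a derivative is a boundary regular fixed point of
the semigroup. -/
theorem flow_hasAngularDerivAtFixed {φ : ℝ → ℂ → ℂ} {G : ℂ → ℂ} {σ : ℂ} {μ : ℝ} (hσ : ‖σ‖ = 1)
    (hφ : IsOneParamSemigroup φ) (hgen : IsGeneratorOf G φ)
    (hlim : Tendsto (fun z => G z / (σ - z)) (𝓝[disk] σ) (𝓝 (μ : ℂ))) {t : ℝ} (ht : 0 ≤ t) :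
    HasAngularDerivAtFixed (φ t) σ ((Real.exp (-(μ * t)) : ℝ) : ℂ) := by
  -- Near `σ` the generator satisfies `‖G w‖ ≤ (|μ| + ε) * ‖w - σ‖`, and only `ε < 1` will be used.
  set K : ℝ := |μ| + 1 with hKdef
  have hK : 0 < K := by positivity
  set A : ℝ := Real.exp (K * t) with hA
  have hA0 : 0 < A := Real.exp_pos _
  have hmain : ∀ ε : ℝ, 0 < ε → ε < 1 → ∀ᶠ z in 𝓝[disk] σ, ∀ s ∈ Icc 0 t,
      ‖φ s z - σ‖ ≤ ‖z - σ‖ * A ∧ ‖G (φ s z) + (μ : ℂ) * (φ s z - σ)‖ ≤ ε * ‖φ s z - σ‖ := by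
    intro ε hε hε1
    obtain ⟨δ, hδ, hb⟩ := Metric.eventually_nhds_iff.1 (eventually_nhdsWithin_iff.1
      (Metric.tendsto_nhds.1 hlim ε hε))
    have hGb : ∀ w ∈ disk, ‖w - σ‖ < δ → ‖G w + (μ : ℂ) * (w - σ)‖ ≤ ε * ‖w - σ‖ := by
      intro w hw hwδ
      have h1 := hb (by rwa [dist_eq_norm]) hw
      have h2 := sub_ne_zero_of_mem_disk hσ hw
      rw [dist_eq_norm] at h1
      have h3 : G w + (μ : ℂ) * (w - σ) = (G w / (σ - w) - μ) * (σ - w) := by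
        rw [sub_mul, div_mul_cancel₀ _ h2]; ring
      rw [h3, norm_mul, norm_sub_rev σ w]
      gcongr
    have hsmall : ∀ᶠ z in 𝓝[disk] σ, ‖z - σ‖ < δ / A := by
      refine eventually_nhdsWithin_of_eventually_nhds ?_
      filter_upwards [Metric.ball_mem_nhds σ (div_pos hδ hA0)] with z hz
      rwa [← dist_eq_norm]
    filter_upwards [hsmall, self_mem_nhdsWithin] with z hz hzd s hs
    have hzσ : 0 < ‖z - σ‖ := by
      rw [norm_sub_rev]
      exact norm_pos_iff.2 (sub_ne_zero_of_mem_disk hσ hzd)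
    rw [lt_div_iff₀ hA0] at hz
    have hd : ∀ x, 0 ≤ x → HasDerivWithinAt (fun s => φ s z - σ) (G (φ x z)) (Ici 0) x :=
      fun x hx => (hgen.2 z hzd x hx).sub_const σ
    have hexp : ∀ x ∈ Icc 0 t, ‖z - σ‖ * Real.exp (K * x) ≤ ‖z - σ‖ * A := by
      intro x hx
      rw [hA]
      gcongr
      exact hx.2
    -- Barrier argument: the strict inequality is required only where the norm touches the barrier,
    -- and there the point is within `δ` of `σ`, so the bound on `G` is available.
    have hle := image_norm_le_of_norm_deriv_right_lt_deriv_boundary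
      (f := fun s => φ s z - σ) (a := 0) (b := t)
      (fun x hx => ((hd x hx.1).mono Icc_subset_Ici_self).continuousWithinAt)
      (fun x hx => (hd x hx.1).mono (Ici_subset_Ici.2 hx.1))
      (B := fun x => ‖z - σ‖ * Real.exp (K * x)) (B' := fun x => K * (‖z - σ‖ * Real.exp (K * x)))
      (by simp [hφ.zero z hzd])
      (fun x => by
        have := (((hasDerivAt_id x).const_mul K).exp).const_mul ‖z - σ‖
        refine this.congr_deriv ?_
        simp only [id]; ring)
      (fun x hx heq => by
        have hw := hφ.mapsTo x hx.1 hzd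
        have h1 : ‖φ x z - σ‖ < δ := by
          rw [heq]
          exact (hexp x (Ico_subset_Icc_self hx)).trans_lt hz
        have h2 := hGb _ hw h1
        have h3 : 0 < ‖φ x z - σ‖ := by
          rw [heq]; positivity
        rw [← heq]
        calc ‖G (φ x z)‖ = ‖(G (φ x z) + (μ : ℂ) * (φ x z - σ)) - (μ : ℂ) * (φ x z - σ)‖ := by
              congr 1; ring
          _ ≤ ‖G (φ x z) + (μ : ℂ) * (φ x z - σ)‖ + ‖(μ : ℂ) * (φ x z - σ)‖ := norm_sub_le _ _
          _ ≤ ε * ‖φ x z - σ‖ + |μ| * ‖φ x z - σ‖ := by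
              rw [norm_mul, Complex.norm_real, Real.norm_eq_abs]
              gcongr
          _ < K * ‖φ x z - σ‖ := by rw [hKdef]; nlinarith) hs
    have h1 := hle.trans (hexp s hs)
    exact ⟨h1, hGb _ (hφ.mapsTo s hs.1 hzd) (h1.trans_lt hz)⟩
  refine ⟨hσ, hasAngularLimit_of_tendsto_disk ?_, hasAngularLimit_of_tendsto_disk ?_⟩
  · rw [tendsto_iff_norm_sub_tendsto_zero]
    have h1 : Tendsto (fun z => ‖z - σ‖ * A) (𝓝[disk] σ) (𝓝 0) := by
      have : Continuous fun z : ℂ => ‖z - σ‖ * A := by fun_prop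
      have h := this.tendsto σ
      simp only [sub_self, norm_zero, zero_mul] at h
      exact h.mono_left nhdsWithin_le_nhds
    refine squeeze_zero' (Eventually.of_forall fun _ => norm_nonneg _) ?_ h1
    filter_upwards [hmain (1 / 2) (by norm_num) (by norm_num)] with z hz
    exact (hz t (right_mem_Icc.2 ht)).1
  · rw [Metric.tendsto_nhds]
    intro η hη
    set E : ℝ := Real.exp (|μ| * t) with hE
    have hE0 : 0 < E := Real.exp_pos _
    -- `E` bounds both `exp (μ s)` and `exp (-μ t)`; the accumulated relative error is at most `ε *
    -- (E * (E * A * t))`. The added `1` keeps `c` positive when `t = 0`.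
    set c : ℝ := E * (E * A * t) + 1
    have hc : 0 < c := by positivity
    set ε : ℝ := min (1 / 2) (η / c)
    have hε : 0 < ε := lt_min (by norm_num) (by positivity)
    filter_upwards [hmain ε hε ((min_le_left _ _).trans_lt (by norm_num)), self_mem_nhdsWithin]
      with z hz hzd
    have hzσ : 0 < ‖z - σ‖ := by
      rw [norm_sub_rev]
      exact norm_pos_iff.2 (sub_ne_zero_of_mem_disk hσ hzd)
    have hzσ' : z - σ ≠ 0 := norm_pos_iff.1 hzσ
    have habs : ∀ x ∈ Icc 0 t, Real.exp (μ * x) ≤ E := fun x hx => by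
      rw [hE]
      refine Real.exp_le_exp.2 ?_
      calc μ * x ≤ |μ| * x := mul_le_mul_of_nonneg_right (le_abs_self _) hx.1
        _ ≤ |μ| * t := by gcongr; exact hx.2
    -- The integrating factor removes the linear part of the flow, leaving only the deviation of `G`
    -- from `-μ (w - σ)`.
    have hd : ∀ x ∈ Icc 0 t, HasDerivWithinAt
        (fun s : ℝ => ((Real.exp (μ * s) : ℝ) : ℂ) * (φ s z - σ))
        (((Real.exp (μ * x) : ℝ) : ℂ) * (G (φ x z) + (μ : ℂ) * (φ x z - σ))) (Icc 0 t) x := by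
      intro x hx
      have h1 : HasDerivAt (fun s : ℝ => ((Real.exp (μ * s) : ℝ) : ℂ))
          ((Real.exp (μ * x) * μ : ℝ) : ℂ) x := by
        have := ((hasDerivAt_id x).const_mul μ).exp
        simp only [id, mul_one] at this
        exact this.ofReal_comp
      have h2 := h1.hasDerivWithinAt (s := Icc 0 t) |>.mul
        (((hgen.2 z hzd x hx.1).sub_const σ).mono Icc_subset_Ici_self)
      refine h2.congr_deriv ?_
      push_cast
      ring
    have hbound := norm_image_sub_le_of_norm_deriv_le_segment' hd
      (C := E * (ε * (‖z - σ‖ * A))) (fun x hx => by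
        have hx' := Ico_subset_Icc_self hx
        rw [norm_mul, Complex.norm_real, Real.norm_of_nonneg (Real.exp_pos _).le]
        refine mul_le_mul (habs x hx') ?_ (norm_nonneg _) hE0.le
        exact (hz x hx').2.trans (mul_le_mul_of_nonneg_left (hz x hx').1 hε.le))
      t (right_mem_Icc.2 ht)
    simp only [mul_zero, Real.exp_zero, Complex.ofReal_one, one_mul, sub_zero, hφ.zero z hzd]
      at hbound
    have hee : Real.exp (-(μ * t)) * Real.exp (μ * t) = 1 := by
      rw [← Real.exp_add]; simp
    have hee' : ((Real.exp (-(μ * t)) : ℝ) : ℂ) * ((Real.exp (μ * t) : ℝ) : ℂ) = 1 := by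
      exact_mod_cast hee
    have hfin : (φ t z - σ) / (z - σ) - ((Real.exp (-(μ * t)) : ℝ) : ℂ) =
        ((Real.exp (-(μ * t)) : ℝ) : ℂ) *
          (((Real.exp (μ * t) : ℝ) : ℂ) * (φ t z - σ) - (z - σ)) / (z - σ) := by
      rw [mul_sub, ← mul_assoc, hee', one_mul]
      field_simp
    have hneg : Real.exp (-(μ * t)) ≤ E := by
      rw [hE]
      refine Real.exp_le_exp.2 ?_
      rw [← neg_mul]
      exact mul_le_mul_of_nonneg_right (neg_le_abs μ) ht
    rw [dist_eq_norm, hfin, norm_div, norm_mul, Complex.norm_real,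
      Real.norm_of_nonneg (Real.exp_pos _).le, div_lt_iff₀ hzσ]
    calc Real.exp (-(μ * t)) * ‖((Real.exp (μ * t) : ℝ) : ℂ) * (φ t z - σ) - (z - σ)‖
        ≤ E * (E * (ε * (‖z - σ‖ * A)) * t) := mul_le_mul hneg hbound (norm_nonneg _) hE0.le
      _ = ε * (E * (E * A * t)) * ‖z - σ‖ := by ring
      _ < ε * c * ‖z - σ‖ := by
        gcongr
        exact lt_add_one _
      _ ≤ η / c * c * ‖z - σ‖ := by
        gcongr
        exact min_le_right _ _
      _ = η * ‖z - σ‖ := by field_simp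

theorem HasSpectralValueAt.congr {G G' : ℂ → ℂ} {τ : ℂ} {ω : ℝ} (h : HasSpectralValueAt G τ ω)
    (heq : EqOn G G' disk) : HasSpectralValueAt G' τ ω := by
  obtain ⟨φ, hφ, hgen, hc⟩ := h
  refine ⟨φ, hφ, ⟨hgen.1.congr fun z hz => (heq hz).symm, fun z hz t ht => ?_⟩, hc⟩
  rw [← heq (hφ.mapsTo t ht hz)]
  exact hgen.2 z hz t ht

/-- The limit at `τ` serves twice: it gives the linear growth needed for the semigroup to exist, and
the spectral value. -/
theorem mem_gen_of_tendsto {τ : ℂ} {σ : Fin n → ℂ} {Λ : Fin n → ℝ} {G : ℂ → ℂ} {ω : ℝ}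
    (hτ : ‖τ‖ = 1) (hσ : ∀ k, ‖σ k‖ = 1) (hG : DifferentiableOn ℂ G disk)
    (hpos : ∀ z ∈ disk, 0 < (berksonPorta τ G z).re) (hω : 0 ≤ ω)
    (hlim : Tendsto (fun z => G z / (τ - z)) (𝓝[disk] τ) (𝓝 (ω : ℂ)))
    (hlimσ : ∀ k, ∃ μ : ℝ, Λ k ≤ μ ∧ μ ≤ 0 ∧
      Tendsto (fun z => G z / (σ k - z)) (𝓝[disk] (σ k)) (𝓝 (μ : ℂ))) :
    G ∈ Gen τ σ Λ ∧ HasSpectralValueAt G τ ω := by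
  have hC : ∀ᶠ z in 𝓝[disk] τ, ‖G z‖ ≤ (ω + 1) * ‖τ - z‖ := by
    have h1 := hlim.norm
    rw [Complex.norm_real, Real.norm_of_nonneg hω] at h1
    filter_upwards [h1.eventually (gt_mem_nhds (lt_add_one ω)), self_mem_nhdsWithin] with z hz hzd
    have := norm_pos_iff.2 (sub_ne_zero_of_mem_disk hτ hzd)
    rw [norm_div, div_lt_iff₀ this] at hz
    exact hz.le
  obtain ⟨φ, hφ, hgen, hfix⟩ := exists_semigroup hτ hG hpos hC
  refine ⟨⟨φ, hφ, hgen, ?_, ?_⟩, φ, hφ, hgen, fun t ht =>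
    flow_hasAngularDerivAtFixed hτ hφ hgen hlim ht⟩
  · intro t ht hid
    have ht0 : 0 < t := by
      refine lt_of_le_of_ne ht fun h0 => hid fun z hz => ?_
      rw [← h0, hφ.zero z hz, id]
    refine Or.inr ⟨hfix t ht0, _, ?_, flow_hasAngularDerivAtFixed hτ hφ hgen hlim ht⟩
    rw [Real.exp_le_one_iff, neg_nonpos]
    positivity
  · intro k
    obtain ⟨μ, h1, h2, h3⟩ := hlimσ k
    exact ⟨μ, h1, h2, fun t ht => ⟨_, flow_hasAngularDerivAtFixed (hσ k) hφ hgen h3 ht⟩,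
      hasAngularLimit_of_tendsto_disk h3⟩

theorem zero_mem_gen {τ : ℂ} {σ : Fin n → ℂ} {Λ : Fin n → ℝ} (hτ : ‖τ‖ = 1)
    (hσ : ∀ k, ‖σ k‖ = 1) (hΛ : ∀ k, Λ k < 0) :
    (fun _ => 0) ∈ Gen τ σ Λ ∧ HasSpectralValueAt (fun _ => 0) τ 0 := by
  have hsg : IsOneParamSemigroup fun _ z => z :=
    ⟨fun _ _ => differentiableOn_id, fun _ _ => mapsTo_id _, fun _ _ => rfl,
      fun _ _ _ _ _ _ => rfl, fun _ _ => tendsto_const_nhds⟩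
  have hgen : IsGeneratorOf (fun _ => 0) fun _ z => z :=
    ⟨differentiableOn_const _, fun z _ t _ => hasDerivWithinAt_const t (Ici 0) z⟩
  have hlim : ∀ s : ℂ, Tendsto (fun z : ℂ => (0 : ℂ) / (s - z)) (𝓝[disk] s) (𝓝 ((0 : ℝ) : ℂ)) := by
    intro s
    simpa using tendsto_const_nhds
  refine ⟨⟨_, hsg, hgen, fun t _ hid => absurd (fun z _ => rfl) hid, fun k =>
    ⟨0, (hΛ k).le, le_rfl, fun t ht =>
      ⟨_, flow_hasAngularDerivAtFixed (hσ k) hsg hgen (hlim _) ht⟩,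
      hasAngularLimit_of_tendsto_disk (hlim _)⟩⟩, _, hsg, hgen, fun t ht =>
      flow_hasAngularDerivAtFixed hτ hsg hgen (hlim _) ht⟩

/-! ### Generators built from a parameter function. -/

/-- The generator with reciprocal Berkson-Porta function `p0 - p0 τ + h`. -/
def genOf (τ : ℂ) (σ : Fin n → ℂ) (Λ : Fin n → ℝ) (h : ℂ → ℂ) (z : ℂ) : ℂ :=
  (τ - z) * (1 - conj τ * z) / (p0 τ σ Λ z - p0 τ σ Λ τ + h z)

theorem herglotz_boundary {s τ : ℂ} (hs : ‖s‖ = 1) (hτ : ‖τ‖ = 1) (hne : s ≠ τ) :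
    herglotz s τ = Complex.I * ((2 * (conj s * τ).im / ‖τ - s‖ ^ 2 : ℝ) : ℂ) := by
  have h1 := sub_ne_zero.2 hne
  have h2 : ((‖τ - s‖ ^ 2 : ℝ) : ℂ) = (s - τ) * conj (s - τ) := by
    rw [Complex.mul_conj, Complex.normSq_eq_norm_sq, norm_sub_rev]
  have h3 : conj (s - τ) ≠ 0 := (map_ne_zero _).2 h1
  have h4 : (2 * (conj s * τ).im : ℂ) * Complex.I = conj s * τ - s * conj τ := by
    have := Complex.sub_conj (conj s * τ)
    simp only [map_mul, Complex.conj_conj] at this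
    rw [this]
    push_cast
    ring
  rw [herglotz, Complex.ofReal_div, h2, ← mul_div_assoc, div_eq_div_iff h1 (mul_ne_zero h1 h3)]
  push_cast
  rw [mul_comm Complex.I, h4, map_sub]
  linear_combination (s - τ) * conj_mul_self_of_norm_one hs -
    (s - τ) * conj_mul_self_of_norm_one hτ

theorem alpha_pos {τ : ℂ} {σ : Fin n → ℂ} {Λ : Fin n → ℝ} (hτσ : ∀ k, τ ≠ σ k)
    (hΛ : ∀ k, Λ k < 0) (k : Fin n) : 0 < alpha τ σ Λ k := by
  have h1 := norm_pos_iff.2 (sub_ne_zero.2 (hτσ k))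
  have h2 := abs_pos.2 (hΛ k).ne
  rw [alpha]
  positivity

theorem sumAlpha_pos {τ : ℂ} {σ : Fin n → ℂ} {Λ : Fin n → ℝ} (hn : 1 ≤ n) (hτσ : ∀ k, τ ≠ σ k)
    (hΛ : ∀ k, Λ k < 0) : 0 < sumAlpha τ σ Λ :=
  Finset.sum_pos (fun k _ => alpha_pos hτσ hΛ k) ⟨⟨0, hn⟩, Finset.mem_univ _⟩

theorem sumInv_pos {Λ : Fin n → ℝ} (hn : 1 ≤ n) (hΛ : ∀ k, Λ k < 0) : 0 < sumInv Λ :=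
  Finset.sum_pos (fun k _ => inv_pos.2 (abs_pos.2 (hΛ k).ne)) ⟨⟨0, hn⟩, Finset.mem_univ _⟩

/-- This is the imaginary shift that appears in `ω_ζ`. -/
theorem p0_boundary {τ : ℂ} {σ : Fin n → ℂ} {Λ : Fin n → ℝ} (hτ : ‖τ‖ = 1)
    (hσ : ∀ k, ‖σ k‖ = 1) (hτσ : ∀ k, τ ≠ σ k) (hΛ : ∀ k, Λ k < 0) :
    p0 τ σ Λ τ = Complex.I * ((∑ k, |Λ k|⁻¹ * (conj (σ k) * τ).im : ℝ) : ℂ) := by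
  rw [p0_eq, Complex.ofReal_sum, Finset.mul_sum]
  refine Finset.sum_congr rfl fun k _ => ?_
  rw [herglotz_boundary (hσ k) hτ (hτσ k).symm, mul_left_comm, ← Complex.ofReal_mul]
  congr 2
  have h1 := (norm_pos_iff.2 (sub_ne_zero.2 (hτσ k))).ne'
  have h2 := (abs_pos.2 (hΛ k).ne).ne'
  rw [alpha]
  field_simp

theorem p0_boundary_re {τ : ℂ} {σ : Fin n → ℂ} {Λ : Fin n → ℝ} (hτ : ‖τ‖ = 1)
    (hσ : ∀ k, ‖σ k‖ = 1) (hτσ : ∀ k, τ ≠ σ k) (hΛ : ∀ k, Λ k < 0) : (p0 τ σ Λ τ).re = 0 := by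
  rw [p0_boundary hτ hσ hτσ hΛ, mul_comm, Complex.re_ofReal_mul, Complex.I_re, mul_zero]

theorem p0_zero {τ : ℂ} {σ : Fin n → ℂ} {Λ : Fin n → ℝ} (hσ : ∀ k, ‖σ k‖ = 1) :
    p0 τ σ Λ 0 = sumAlpha τ σ Λ := by
  simp only [p0_eq, herglotz_zero (hσ _), mul_one, sumAlpha, Complex.ofReal_sum]

theorem differentiableOn_p0 {τ : ℂ} {σ : Fin n → ℂ} {Λ : Fin n → ℝ} (hσ : ∀ k, ‖σ k‖ = 1) :
    DifferentiableOn ℂ (p0 τ σ Λ) disk := by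
  have : DifferentiableOn ℂ (fun z => ∑ k, (alpha τ σ Λ k : ℂ) * herglotz (σ k) z) disk :=
    DifferentiableOn.fun_sum fun k _ => (differentiableOn_herglotz (hσ k)).const_mul _
  exact this

theorem p0_re_pos {τ : ℂ} {σ : Fin n → ℂ} {Λ : Fin n → ℝ} (hn : 1 ≤ n)
    (hσ : ∀ k, ‖σ k‖ = 1) (hτσ : ∀ k, τ ≠ σ k) (hΛ : ∀ k, Λ k < 0) {z : ℂ} (hz : z ∈ disk) :
    0 < (p0 τ σ Λ z).re := by
  rw [p0_eq, Complex.re_sum]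
  refine Finset.sum_pos (fun k _ => ?_) ⟨⟨0, hn⟩, Finset.mem_univ _⟩
  rw [Complex.re_ofReal_mul]
  exact mul_pos (alpha_pos hτσ hΛ k) (herglotz_re_pos (hσ k) hz)

theorem tendsto_herglotz_sub_div {s τ : ℂ} (hs : ‖s‖ = 1) (hτ : ‖τ‖ = 1) (hne : s ≠ τ) :
    Tendsto (fun z => (herglotz s z - herglotz s τ) / (1 - conj τ * z)) (𝓝[disk] τ)
      (𝓝 ((2 / ‖τ - s‖ ^ 2 : ℝ) : ℂ)) := by
  have h1 := sub_ne_zero.2 hne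
  have hτ0 := ne_zero_of_norm_one hτ
  have h2 : Tendsto (fun z => -(2 * s * τ) / ((s - z) * (s - τ))) (𝓝[disk] τ)
      (𝓝 (-(2 * s * τ) / ((s - τ) * (s - τ)))) := by
    refine tendsto_const_nhds.div ?_ (mul_ne_zero h1 h1)
    have : Continuous fun z => (s - z) * (s - τ) := by fun_prop
    exact (this.tendsto τ).mono_left nhdsWithin_le_nhds
  have h3 : -(2 * s * τ) / ((s - τ) * (s - τ)) = ((2 / ‖τ - s‖ ^ 2 : ℝ) : ℂ) := by
    have h4 := porta_factor_eq (τ := τ) hs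
    have h5 : ((‖τ - s‖ ^ 2 : ℝ) : ℂ) ≠ 0 := by
      have := norm_pos_iff.2 (sub_ne_zero.2 hne.symm)
      exact Complex.ofReal_ne_zero.2 (by positivity)
    rw [Complex.ofReal_div, div_eq_div_iff (mul_ne_zero h1 h1) h5]
    rw [one_sub_conj_mul_eq hτ] at h4
    push_cast at h4 ⊢
    linear_combination -2 * τ * h4 + 2 * (τ - s) ^ 2 * conj_mul_self_of_norm_one hτ
  rw [h3] at h2
  refine h2.congr' ?_
  filter_upwards [self_mem_nhdsWithin] with z hz
  have h4 := sub_ne_zero_of_mem_disk hs hz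
  have h5 := sub_ne_zero_of_mem_disk hτ hz
  have h6 := conj_ne_zero_of_norm_one hτ
  rw [one_sub_conj_mul_eq hτ, herglotz, herglotz, div_sub_div _ _ h4 h1, div_div,
    div_eq_div_iff (mul_ne_zero h4 h1) (mul_ne_zero (mul_ne_zero h4 h1) (mul_ne_zero h6 h5))]
  linear_combination (-2 * s * (τ - z) * (s - z) * (s - τ)) * conj_mul_self_of_norm_one hτ

/-- Each kernel has slope `2 / ‖τ - σ k‖ ^ 2` at `τ`, and the weight `α_k` turns it into `1 / |Λ
k|`. -/
theorem tendsto_p0_sub_div {τ : ℂ} {σ : Fin n → ℂ} {Λ : Fin n → ℝ} (hτ : ‖τ‖ = 1)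
    (hσ : ∀ k, ‖σ k‖ = 1) (hτσ : ∀ k, τ ≠ σ k) (hΛ : ∀ k, Λ k < 0) :
    Tendsto (fun z => (p0 τ σ Λ z - p0 τ σ Λ τ) / (1 - conj τ * z)) (𝓝[disk] τ)
      (𝓝 (sumInv Λ : ℂ)) := by
  have h1 := tendsto_finsetSum Finset.univ fun k (_ : k ∈ Finset.univ) =>
    (tendsto_herglotz_sub_div (hσ k) hτ (hτσ k).symm).const_mul (alpha τ σ Λ k : ℂ)
  have h2 : ∑ k, (alpha τ σ Λ k : ℂ) * ((2 / ‖τ - σ k‖ ^ 2 : ℝ) : ℂ) = (sumInv Λ : ℂ) := by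
    rw [sumInv, Complex.ofReal_sum]
    refine Finset.sum_congr rfl fun k _ => ?_
    rw [← Complex.ofReal_mul]
    congr 1
    have h1 := (norm_pos_iff.2 (sub_ne_zero.2 (hτσ k))).ne'
    have h2 := (abs_pos.2 (hΛ k).ne).ne'
    rw [alpha]
    field_simp
  rw [h2] at h1
  refine h1.congr fun z => ?_
  rw [p0_eq, p0_eq, ← Finset.sum_sub_distrib, Finset.sum_div]
  refine Finset.sum_congr rfl fun k _ => ?_
  ring

theorem tendsto_p0 {τ : ℂ} {σ : Fin n → ℂ} {Λ : Fin n → ℝ} (hτσ : ∀ k, τ ≠ σ k) :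
    Tendsto (p0 τ σ Λ) (𝓝 τ) (𝓝 (p0 τ σ Λ τ)) := by
  refine tendsto_finsetSum _ fun k _ => Tendsto.const_mul _ ?_
  exact (tendsto_id.const_add _).div (tendsto_id.const_sub _) (sub_ne_zero.2 (hτσ k).symm)

theorem tendsto_sub_mul_p0 {τ : ℂ} {σ : Fin n → ℂ} {Λ : Fin n → ℝ} (hinj : Function.Injective σ)
    (hσ : ∀ k, ‖σ k‖ = 1) (k : Fin n) :
    Tendsto (fun z => (σ k - z) * p0 τ σ Λ z) (𝓝[disk] (σ k))
      (𝓝 (2 * σ k * (alpha τ σ Λ k : ℂ))) := by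
  have h1 : ∀ j ∈ Finset.univ, Tendsto (fun z => (σ k - z) * ((alpha τ σ Λ j : ℂ) * herglotz (σ j) z))
      (𝓝[disk] (σ k)) (𝓝 (if j = k then 2 * σ k * (alpha τ σ Λ k : ℂ) else 0)) := by
    intro j _
    have hid : Tendsto (fun z : ℂ => z) (𝓝[disk] (σ k)) (𝓝 (σ k)) := nhdsWithin_le_nhds
    split_ifs with hjk
    · subst hjk
      have h2 : Tendsto (fun z => (alpha τ σ Λ j : ℂ) * (σ j + z)) (𝓝[disk] (σ j))
          (𝓝 ((alpha τ σ Λ j : ℂ) * (σ j + σ j))) := (hid.const_add _).const_mul _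
      have h3 : (alpha τ σ Λ j : ℂ) * (σ j + σ j) = 2 * σ j * (alpha τ σ Λ j : ℂ) := by ring
      rw [h3] at h2
      refine h2.congr' ?_
      filter_upwards [self_mem_nhdsWithin] with z hz
      have := sub_ne_zero_of_mem_disk (hσ j) hz
      rw [herglotz]
      field_simp
    · have h2 := (hid.const_sub (σ k)).mul (((hid.const_add (σ j)).div (hid.const_sub (σ j))
        (sub_ne_zero.2 fun h => hjk (hinj h))).const_mul (alpha τ σ Λ j : ℂ))
      rw [sub_self, zero_mul] at h2
      exact h2
  have h2 := tendsto_finsetSum Finset.univ h1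
  rw [Finset.sum_ite_eq' Finset.univ k, if_pos (Finset.mem_univ k)] at h2
  refine h2.congr fun z => ?_
  rw [p0_eq, Finset.mul_sum]

theorem genOf_mem {τ : ℂ} {σ : Fin n → ℂ} {Λ : Fin n → ℝ} {h : ℂ → ℂ} {ω : ℝ} (hn : 1 ≤ n)
    (hτ : ‖τ‖ = 1) (hσ : ∀ k, ‖σ k‖ = 1) (hinj : Function.Injective σ) (hτσ : ∀ k, τ ≠ σ k)
    (hΛ : ∀ k, Λ k < 0) (hd : DifferentiableOn ℂ h disk) (hpos : ∀ z ∈ disk, 0 ≤ (h z).re)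
    (hω : 0 ≤ ω)
    (hlim : Tendsto (fun z => (1 - conj τ * z) / (p0 τ σ Λ z - p0 τ σ Λ τ + h z)) (𝓝[disk] τ)
      (𝓝 (ω : ℂ)))
    (hlimσ : ∀ k, ∃ β : ℝ, 0 ≤ β ∧
      Tendsto (fun z => (σ k - z) * h z) (𝓝[disk] (σ k)) (𝓝 (2 * σ k * (β : ℂ)))) :
    genOf τ σ Λ h ∈ Gen τ σ Λ ∧ HasSpectralValueAt (genOf τ σ Λ h) τ ω := by
  have hq : ∀ z ∈ disk, 0 < (p0 τ σ Λ z - p0 τ σ Λ τ + h z).re := by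
    intro z hz
    have := p0_re_pos hn hσ hτσ hΛ hz
    have := hpos z hz
    simp only [Complex.add_re, Complex.sub_re, p0_boundary_re hτ hσ hτσ hΛ]
    linarith
  have hq0 : ∀ z ∈ disk, p0 τ σ Λ z - p0 τ σ Λ τ + h z ≠ 0 := fun z hz h0 => by
    have := hq z hz
    simp [h0] at this
  refine mem_gen_of_tendsto hτ hσ ?_ ?_ hω ?_ ?_
  · exact DifferentiableOn.div (by fun_prop)
      (((differentiableOn_p0 hσ).sub_const _).add hd) hq0
  · intro z hz
    have h1 : berksonPorta τ (genOf τ σ Λ h) z = (p0 τ σ Λ z - p0 τ σ Λ τ + h z)⁻¹ := by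
      rw [berksonPorta, genOf, div_div, mul_comm (_ + _), ← div_div,
        div_self (porta_factor_ne_zero hτ hz), one_div]
    rw [h1, re_inv_eq]
    have := hq z hz
    have := norm_pos_iff.2 (hq0 z hz)
    positivity
  · refine hlim.congr' ?_
    filter_upwards [self_mem_nhdsWithin] with z hz
    have := sub_ne_zero_of_mem_disk hτ hz
    rw [genOf]
    field_simp
  · intro k
    obtain ⟨β, hβ, hlimβ⟩ := hlimσ k
    have hα := alpha_pos hτσ hΛ k
    have hdist := norm_pos_iff.2 (sub_ne_zero.2 (hτσ k))
    have hσ0 := ne_zero_of_norm_one (hσ k)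
    have hid : Tendsto (fun z : ℂ => z) (𝓝[disk] (σ k)) (𝓝 (σ k)) := nhdsWithin_le_nhds
    have h1 := ((tendsto_sub_mul_p0 (τ := τ) (Λ := Λ) hinj hσ k).sub
      ((hid.const_sub (σ k)).mul_const (p0 τ σ Λ τ))).add hlimβ
    have hsum : (alpha τ σ Λ k : ℂ) + β ≠ 0 := by
      rw [← Complex.ofReal_add]
      exact Complex.ofReal_ne_zero.2 (by positivity)
    have h2 : 2 * σ k * (alpha τ σ Λ k : ℂ) - (σ k - σ k) * p0 τ σ Λ τ + 2 * σ k * (β : ℂ) =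
        2 * σ k * (alpha τ σ Λ k + β) := by ring
    rw [h2] at h1
    have h3 := ((hid.const_sub τ).mul ((hid.const_mul (conj τ)).const_sub 1)).div h1
      (mul_ne_zero (mul_ne_zero two_ne_zero hσ0) hsum)
    -- An atom `β` of `h` at `σ k` adds to `α_k`; a larger mass moves the spectral value from `Λ k`
    -- towards `0`.
    refine ⟨-(‖τ - σ k‖ ^ 2 / (2 * (alpha τ σ Λ k + β))), ?_, ?_, ?_⟩
    · have h4 : Λ k = -(‖τ - σ k‖ ^ 2 / (2 * alpha τ σ Λ k)) := by
        rw [alpha, abs_of_neg (hΛ k)]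
        have := (hΛ k).ne
        field_simp
      rw [h4, neg_le_neg_iff]
      have h5 : 2 * alpha τ σ Λ k ≤ 2 * (alpha τ σ Λ k + β) := by linarith
      exact div_le_div_of_nonneg_left (by positivity) (by positivity) h5
    · rw [neg_nonpos]
      positivity
    · have h5 : (τ - σ k) * (1 - conj τ * σ k) / (2 * σ k * (alpha τ σ Λ k + β)) =
          ((-(‖τ - σ k‖ ^ 2 / (2 * (alpha τ σ Λ k + β))) : ℝ) : ℂ) := by
        rw [porta_factor_eq (hσ k)]
        push_cast
        field_simp
      rw [h5] at h3
      refine h3.congr' ?_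
      filter_upwards [self_mem_nhdsWithin] with z hz
      have h6 := sub_ne_zero_of_mem_disk (hσ k) hz
      have h7 := hq0 z hz
      have h8 : (σ k - z) * p0 τ σ Λ z - (σ k - z) * p0 τ σ Λ τ + (σ k - z) * h z =
          (p0 τ σ Λ z - p0 τ σ Λ τ + h z) * (σ k - z) := by ring
      simp only [Pi.div_apply]
      rw [genOf, div_div, h8]

theorem tendsto_genOf_of_ne_zero {τ : ℂ} {σ : Fin n → ℂ} {Λ : Fin n → ℝ} {h : ℂ → ℂ} {w : ℂ}
    (hτ : ‖τ‖ = 1) (hτσ : ∀ k, τ ≠ σ k) (hw : w ≠ 0) (hlim : Tendsto h (𝓝[disk] τ) (𝓝 w)) :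
    Tendsto (fun z => (1 - conj τ * z) / (p0 τ σ Λ z - p0 τ σ Λ τ + h z)) (𝓝[disk] τ)
      (𝓝 ((0 : ℝ) : ℂ)) := by
  have hid : Tendsto (fun z : ℂ => z) (𝓝[disk] τ) (𝓝 τ) := nhdsWithin_le_nhds
  have h1 := ((hid.const_mul (conj τ)).const_sub 1).div
    ((((tendsto_p0 (Λ := Λ) hτσ).mono_left nhdsWithin_le_nhds).sub_const (p0 τ σ Λ τ)).add hlim)
    (by simpa using hw)
  rw [conj_mul_self_of_norm_one hτ, sub_self, zero_div] at h1
  rw [Complex.ofReal_zero]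
  exact h1

theorem tendsto_genOf_of_zero {τ : ℂ} {σ : Fin n → ℂ} {Λ : Fin n → ℝ} {h : ℂ → ℂ} {d : ℝ}
    (hn : 1 ≤ n) (hτ : ‖τ‖ = 1) (hσ : ∀ k, ‖σ k‖ = 1) (hτσ : ∀ k, τ ≠ σ k) (hΛ : ∀ k, Λ k < 0)
    (hd : 0 ≤ d) (hlim : Tendsto (fun z => h z / (1 - conj τ * z)) (𝓝[disk] τ) (𝓝 (d : ℂ))) :
    Tendsto (fun z => (1 - conj τ * z) / (p0 τ σ Λ z - p0 τ σ Λ τ + h z)) (𝓝[disk] τ)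
      (𝓝 (((sumInv Λ + d)⁻¹ : ℝ) : ℂ)) := by
  have hS := sumInv_pos hn hΛ
  have h1 := ((tendsto_p0_sub_div hτ hσ hτσ hΛ).add hlim).inv₀ (by
    rw [← Complex.ofReal_add]
    exact Complex.ofReal_ne_zero.2 (by positivity))
  rw [← Complex.ofReal_add, ← Complex.ofReal_inv] at h1
  refine h1.congr fun z => ?_
  rw [← add_div, inv_div]

theorem tendsto_sub_mul_of_tendsto {h : ℂ → ℂ} {s l : ℂ} (hlim : Tendsto h (𝓝[disk] s) (𝓝 l)) :
    ∃ β : ℝ, 0 ≤ β ∧ Tendsto (fun z => (s - z) * h z) (𝓝[disk] s) (𝓝 (2 * s * (β : ℂ))) := by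
  refine ⟨0, le_rfl, ?_⟩
  have hid : Tendsto (fun z : ℂ => z) (𝓝[disk] s) (𝓝 s) := nhdsWithin_le_nhds
  have := (hid.const_sub s).mul hlim
  rw [sub_self, zero_mul] at this
  simpa using this

section

variable {τ : ℂ} {σ : Fin n → ℂ} {Λ : Fin n → ℝ}

theorem genOf_const_mem (hn : 1 ≤ n) (hτ : ‖τ‖ = 1) (hσ : ∀ k, ‖σ k‖ = 1)
    (hinj : Function.Injective σ) (hτσ : ∀ k, τ ≠ σ k) (hΛ : ∀ k, Λ k < 0) {w : ℂ} (hw : w ≠ 0)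
    (hre : 0 ≤ w.re) : genOf τ σ Λ (fun _ => w) ∈ Gen τ σ Λ ∧
      HasSpectralValueAt (genOf τ σ Λ fun _ => w) τ 0 :=
  genOf_mem hn hτ hσ hinj hτσ hΛ (differentiableOn_const _) (fun _ _ => hre) le_rfl
    (tendsto_genOf_of_ne_zero hτ hτσ hw tendsto_const_nhds)
    fun _ => tendsto_sub_mul_of_tendsto tendsto_const_nhds

theorem genOf_zero_mem (hn : 1 ≤ n) (hτ : ‖τ‖ = 1) (hσ : ∀ k, ‖σ k‖ = 1)
    (hinj : Function.Injective σ) (hτσ : ∀ k, τ ≠ σ k) (hΛ : ∀ k, Λ k < 0) :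
    genOf τ σ Λ (fun _ => 0) ∈ Gen τ σ Λ ∧
      HasSpectralValueAt (genOf τ σ Λ fun _ => 0) τ (sumInv Λ)⁻¹ := by
  have h1 := tendsto_genOf_of_zero (σ := σ) (h := fun _ => 0) hn hτ hσ hτσ hΛ le_rfl
    (by simpa using tendsto_const_nhds)
  rw [add_zero] at h1
  exact genOf_mem hn hτ hσ hinj hτσ hΛ (differentiableOn_const _) (fun _ _ => le_rfl)
    (inv_nonneg.2 (sumInv_pos hn hΛ).le) h1
    fun _ => tendsto_sub_mul_of_tendsto tendsto_const_nhds

/-- These realise the spectral values strictly between `0` and the maximum: `1 / h` has an atom `m`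
at `τ`, so `h` vanishes there with slope `1 / (2 * m)`. Positivity of `b.re` keeps `1 / h` away from
zero at each `σ k`. -/
theorem genOf_inv_mem (hn : 1 ≤ n) (hτ : ‖τ‖ = 1) (hσ : ∀ k, ‖σ k‖ = 1)
    (hinj : Function.Injective σ) (hτσ : ∀ k, τ ≠ σ k) (hΛ : ∀ k, Λ k < 0) {m : ℝ} (hm : 0 < m)
    {b : ℂ} (hb : 0 < b.re) :
    genOf τ σ Λ (fun z => (m * herglotz τ z + b)⁻¹) ∈ Gen τ σ Λ ∧
      HasSpectralValueAt (genOf τ σ Λ fun z => (m * herglotz τ z + b)⁻¹) τ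
        (sumInv Λ + (2 * m)⁻¹)⁻¹ := by
  have hre : ∀ z, 0 ≤ (herglotz τ z).re → 0 < ((m : ℂ) * herglotz τ z + b).re := by
    intro z hz
    rw [Complex.add_re, Complex.re_ofReal_mul]
    have := mul_nonneg hm.le hz
    linarith
  have hne : ∀ z, 0 ≤ (herglotz τ z).re → (m : ℂ) * herglotz τ z + b ≠ 0 := fun z hz h0 => by
    have := hre z hz
    simp [h0] at this
  have hS := sumInv_pos hn hΛ
  have hid : ∀ s : ℂ, Tendsto (fun z : ℂ => z) (𝓝[disk] s) (𝓝 s) := fun _ => nhdsWithin_le_nhds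
  refine genOf_mem hn hτ hσ hinj hτσ hΛ ?_ ?_ (by positivity)
    (tendsto_genOf_of_zero hn hτ hσ hτσ hΛ (by positivity) ?_) fun k => ?_
  · exact (((differentiableOn_herglotz hτ).const_mul _).add_const _).inv fun z hz =>
      hne z (herglotz_re_pos hτ hz).le
  · intro z hz
    have h1 := herglotz_re_pos hτ hz
    rw [re_inv_eq]
    exact div_nonneg (hre z h1.le).le (by positivity)
  · have hc := conj_mul_self_of_norm_one hτ
    have h1 : Tendsto (fun z => conj τ * (m * (τ + z) + b * (τ - z))) (𝓝[disk] τ)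
        (𝓝 ((2 * m : ℝ) : ℂ)) := by
      have h2 := (((hid τ).const_add τ).const_mul (m : ℂ)).add
        (((hid τ).const_sub τ).const_mul b) |>.const_mul (conj τ)
      have h3 : conj τ * ((m : ℂ) * (τ + τ) + b * (τ - τ)) = ((2 * m : ℝ) : ℂ) := by
        push_cast
        linear_combination 2 * m * hc
      rwa [h3] at h2
    have h4 := h1.inv₀ (Complex.ofReal_ne_zero.2 (by positivity))
    rw [← Complex.ofReal_inv] at h4
    refine h4.congr' ?_
    filter_upwards [self_mem_nhdsWithin] with z hz
    have h5 := sub_ne_zero_of_mem_disk hτ hz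
    rw [one_sub_conj_mul_eq hτ, ← one_div, ← one_div, div_div]
    congr 1
    rw [herglotz]
    field_simp
  · refine tendsto_sub_mul_of_tendsto (l := ((m : ℂ) * herglotz τ (σ k) + b)⁻¹) ?_
    refine Tendsto.inv₀ (Tendsto.add_const _ (Tendsto.const_mul _ ?_)) (hne _ ?_)
    · exact ((hid _).const_add τ).div ((hid _).const_sub τ) (sub_ne_zero.2 (hτσ k))
    · rw [herglotz_boundary hτ (hσ k) (hτσ k), mul_comm, Complex.re_ofReal_mul, Complex.I_re,
        mul_zero]

theorem herglotz_boundary_re {s τ : ℂ} (hs : ‖s‖ = 1) (hτ : ‖τ‖ = 1) (hne : s ≠ τ) :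
    (herglotz s τ).re = 0 := by
  rw [herglotz_boundary hs hτ hne, mul_comm, Complex.re_ofReal_mul, Complex.I_re, mul_zero]

/-- The extremal functions. The pole `s` may coincide with some `σ k`, in which case its mass `a`
joins `α_k`. -/
theorem genOf_herglotz_mem (hn : 1 ≤ n) (hτ : ‖τ‖ = 1) (hσ : ∀ k, ‖σ k‖ = 1)
    (hinj : Function.Injective σ) (hτσ : ∀ k, τ ≠ σ k) (hΛ : ∀ k, Λ k < 0) {a : ℝ} (ha : 0 ≤ a)
    {s : ℂ} (hs : ‖s‖ = 1) (hsτ : s ≠ τ) :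
    genOf τ σ Λ (fun z => a * (herglotz s z - herglotz s τ)) ∈ Gen τ σ Λ ∧
      HasSpectralValueAt (genOf τ σ Λ fun z => a * (herglotz s z - herglotz s τ)) τ
        (sumInv Λ + a * (2 / ‖τ - s‖ ^ 2))⁻¹ := by
  have hS := sumInv_pos hn hΛ
  have hid : ∀ s : ℂ, Tendsto (fun z : ℂ => z) (𝓝[disk] s) (𝓝 s) := fun _ => nhdsWithin_le_nhds
  refine genOf_mem hn hτ hσ hinj hτσ hΛ ?_ ?_ (by positivity)
    (tendsto_genOf_of_zero hn hτ hσ hτσ hΛ (by positivity) ?_) fun k => ?_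
  · exact ((differentiableOn_herglotz hs).sub_const _).const_mul _
  · intro z hz
    rw [Complex.re_ofReal_mul, Complex.sub_re, herglotz_boundary_re hs hτ hsτ, sub_zero]
    exact mul_nonneg ha (herglotz_re_pos hs hz).le
  · have := (tendsto_herglotz_sub_div hs hτ hsτ).const_mul (a : ℂ)
    rw [← Complex.ofReal_mul] at this
    exact this.congr fun z => by rw [mul_div_assoc]
  · by_cases hk : s = σ k
    · rw [← hk]
      refine ⟨a, ha, ?_⟩
      have h1 := (((hid s).const_add s).sub (((hid s).const_sub s).mul_const
        (herglotz s τ))).const_mul (a : ℂ)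
      have h2 : (a : ℂ) * (s + s - (s - s) * herglotz s τ) = 2 * s * a := by ring
      rw [h2] at h1
      refine h1.congr' ?_
      filter_upwards [self_mem_nhdsWithin] with z hz
      have h3 := sub_ne_zero_of_mem_disk hs hz
      rw [herglotz.eq_def s z]
      field_simp
    · refine tendsto_sub_mul_of_tendsto (l := (a : ℂ) * (herglotz s (σ k) - herglotz s τ)) ?_
      refine Tendsto.const_mul _ (Tendsto.sub_const ?_ _)
      exact ((hid _).const_add s).div ((hid _).const_sub s) (sub_ne_zero.2 hk)

/-! ### Recovering the parameter and bounding the spectral value. -/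

/-- The value at the origin of the positive-real-part parameter of a generator. -/
def paramValue (τ : ℂ) (σ : Fin n → ℂ) (Λ : Fin n → ℝ) (ζ : ℂ) : ℂ := ell τ σ Λ ζ + p0 τ σ Λ τ

theorem paramValue_re (hτ : ‖τ‖ = 1) (hσ : ∀ k, ‖σ k‖ = 1) (hτσ : ∀ k, τ ≠ σ k)
    (hΛ : ∀ k, Λ k < 0) (ζ : ℂ) : (paramValue τ σ Λ ζ).re = (ell τ σ Λ ζ).re := by
  rw [paramValue, Complex.add_re, p0_boundary_re hτ hσ hτσ hΛ, add_zero]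

theorem omegaMax_eq (hτ : ‖τ‖ = 1) (hσ : ∀ k, ‖σ k‖ = 1) (hτσ : ∀ k, τ ≠ σ k)
    (hΛ : ∀ k, Λ k < 0) (ζ : ℂ) : omegaMax τ σ Λ ζ = fRatio Λ (paramValue τ σ Λ ζ) := by
  rw [omegaMax, paramValue, p0_boundary hτ hσ hτσ hΛ]

theorem genOf_apply_zero (hτ : ‖τ‖ = 1) (hσ : ∀ k, ‖σ k‖ = 1) {h : ℂ → ℂ} {ζ : ℂ} (hζ : ζ ≠ 0)
    (h0 : h 0 = paramValue τ σ Λ ζ) : genOf τ σ Λ h 0 = ζ := by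
  have hτ0 := ne_zero_of_norm_one hτ
  have h1 : p0 τ σ Λ 0 - p0 τ σ Λ τ + h 0 = τ / ζ := by
    rw [h0, paramValue, ell, p0_zero hσ]; ring
  rw [genOf, h1]
  field_simp
  simp

theorem berksonPorta_genOf (hτ : ‖τ‖ = 1) (h : ℂ → ℂ) {z : ℂ} (hz : z ∈ disk) :
    berksonPorta τ (genOf τ σ Λ h) z = (p0 τ σ Λ z - p0 τ σ Λ τ + h z)⁻¹ := by
  rw [berksonPorta, genOf, div_div, mul_comm (_ + _), ← div_div,
    div_self (porta_factor_ne_zero hτ hz), one_div]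

/-- Every generator in the class that does not vanish at the origin comes from a function with
nonnegative real part. -/
theorem exists_eq_genOf (hn : 1 ≤ n) (hτ : ‖τ‖ = 1) (hσ : ∀ k, ‖σ k‖ = 1)
    (hinj : Function.Injective σ) (hτσ : ∀ k, τ ≠ σ k) (hΛ : ∀ k, Λ k < 0) {G : ℂ → ℂ}
    (hG : G ∈ Gen τ σ Λ) (hG0 : G 0 ≠ 0) :
    ∃ h : ℂ → ℂ, DifferentiableOn ℂ h disk ∧ (∀ z ∈ disk, 0 ≤ (h z).re) ∧
      h 0 = paramValue τ σ Λ (G 0) ∧ EqOn G (genOf τ σ Λ h) disk := by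
  have hpos := (eq_zero_or_berksonPorta_re_pos hn hτ hσ hτσ hG).resolve_left
    fun h => hG0 (h 0 zero_mem_disk)
  have hle := p0_re_le_inv_berksonPorta hτ hσ hinj hτσ hG hpos
  obtain ⟨φ, -, hgen, -⟩ := hG
  have hne : ∀ z ∈ disk, berksonPorta τ G z ≠ 0 := fun z hz h0 => by
    have := hpos z hz
    simp [h0] at this
  refine ⟨fun z => (berksonPorta τ G z)⁻¹ - p0 τ σ Λ z + p0 τ σ Λ τ, ?_, ?_, ?_, ?_⟩
  · exact (((differentiableOn_berksonPorta hτ hgen.1).inv hne).sub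
      (differentiableOn_p0 hσ)).add_const _
  · intro z hz
    have := hle z hz
    simp only [Complex.add_re, Complex.sub_re, p0_boundary_re hτ hσ hτσ hΛ]
    linarith
  · simp only [berksonPorta, paramValue, ell, p0_zero hσ, sub_zero, mul_zero, mul_one, inv_div]
  · intro z hz
    have h1 : p0 τ σ Λ z - p0 τ σ Λ τ + ((berksonPorta τ G z)⁻¹ - p0 τ σ Λ z + p0 τ σ Λ τ) =
        (berksonPorta τ G z)⁻¹ := by ring
    have h2 := porta_factor_ne_zero hτ hz
    rw [genOf, h1, div_inv_eq_mul, berksonPorta, mul_div_cancel₀ _ h2]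

/-- A positive spectral value makes `1 / p` vanish at `τ` with slope at most `1 / ω`; subtracting
the slope `sumInv Λ` of `p0` bounds that of `h`, and Julia's lemma follows. -/
theorem julia_genOf (hτ : ‖τ‖ = 1) (hσ : ∀ k, ‖σ k‖ = 1)
    (hτσ : ∀ k, τ ≠ σ k) (hΛ : ∀ k, Λ k < 0) {h : ℂ → ℂ} {ω : ℝ}
    (hd : DifferentiableOn ℂ h disk) (hpos : ∀ z ∈ disk, 0 < (h z).re) (hω : 0 < ω)
    (hsp : HasSpectralValueAt (genOf τ σ Λ h) τ ω) {z : ℂ} (hz : z ∈ disk) :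
    ‖h z‖ ^ 2 * (herglotz τ z).re ≤ 2 * (ω⁻¹ - sumInv Λ) * (h z).re := by
  have hmul := mul_herglotz_le_berksonPorta hsp
  have hid : Tendsto (fun r : ℝ => r) (𝓝[<] 1) (𝓝 1) := nhdsWithin_le_nhds
  set q : ℂ → ℂ := fun z => p0 τ σ Λ z - p0 τ σ Λ τ + h z with hq
  -- Along the radius `ω * Re (herglotz τ) ≤ 2 * Re (1 / q) ≤ 2 / ‖q‖`, which bounds `q` itself and
  -- not only its real part.
  have hqb : ∀ r ∈ Ioo (0 : ℝ) 1, ‖q (r * τ)‖ ≤ 2 / (ω * (1 + r)) * (1 - r) := by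
    intro r hr
    have hrd := mul_mem_disk hτ hr
    have h1 := hmul _ hrd
    rw [herglotz_radial hτ hr, berksonPorta_genOf hτ h hrd] at h1
    have h1r : 0 < 1 - r := by linarith [hr.2]
    have h0r := hr.1
    have h2 : ((q (r * τ))⁻¹).re ≤ ‖q (r * τ)‖⁻¹ := by
      rw [← norm_inv]; exact Complex.re_le_norm _
    have h3 : ω * ((1 + r) / (1 - r)) ≤ 2 * ‖q (r * τ)‖⁻¹ := h1.trans (by gcongr)
    have h4 : 0 < ‖q (r * τ)‖ := by
      by_contra h5
      have h6 : ‖q (r * τ)‖ = 0 := le_antisymm (not_lt.1 h5) (norm_nonneg _)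
      rw [h6, inv_zero, mul_zero] at h3
      have : 0 < ω * ((1 + r) / (1 - r)) := by positivity
      linarith
    rw [← div_eq_mul_inv, le_div_iff₀ h4] at h3
    rw [div_mul_eq_mul_div, le_div_iff₀ (by positivity)]
    calc ‖q (r * τ)‖ * (ω * (1 + r))
        = ω * ((1 + r) / (1 - r)) * ‖q (r * τ)‖ * (1 - r) := by field_simp
      _ ≤ 2 * (1 - r) := by gcongr
  have hcoef : Tendsto (fun r : ℝ => 2 / (ω * (1 + r))) (𝓝[<] 1) (𝓝 ω⁻¹) := by
    have := (tendsto_const_nhds (x := (2 : ℝ))).div ((hid.const_add 1).const_mul ω)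
      (by positivity)
    have h1 : 2 / (ω * (1 + 1)) = ω⁻¹ := by field_simp; norm_num
    rw [h1] at this
    exact this
  have hq0 : Tendsto (fun r : ℝ => q (r * τ)) (𝓝[<] 1) (𝓝 0) := by
    refine squeeze_zero_norm' (eventually_mem_Ioo.mono hqb) ?_
    have := hcoef.mul (hid.const_sub 1)
    rwa [sub_self, mul_zero] at this
  have hp0 := (tendsto_p0 (Λ := Λ) hτσ).comp (tendsto_radial τ)
  refine julia_of_radial_zero hτ hd hpos ?_
    (e := fun r => 2 / (ω * (1 + r)) -
      ((p0 τ σ Λ (r * τ) - p0 τ σ Λ τ) / (1 - conj τ * (r * τ))).re) ?_ ?_ hz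
  · have := hq0.sub (hp0.sub_const (p0 τ σ Λ τ))
    rw [sub_self, sub_zero] at this
    refine this.congr fun r => ?_
    simp only [hq, Function.comp]
    ring
  · refine hcoef.sub ?_
    have := (Complex.continuous_re.tendsto _).comp
      ((tendsto_p0_sub_div hτ hσ hτσ hΛ).comp (tendsto_radial_disk hτ))
    rwa [Complex.ofReal_re] at this
  · filter_upwards [eventually_mem_Ioo] with r hr
    have h1r : 0 < 1 - r := by linarith [hr.2]
    have h1 : 1 - conj τ * (r * τ) = ((1 - r : ℝ) : ℂ) := by
      push_cast
      linear_combination (-(r : ℂ)) * conj_mul_self_of_norm_one hτ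
    have h2 := (Complex.re_le_norm _).trans (hqb r hr)
    rw [h1, Complex.div_ofReal_re, sub_mul, div_mul_cancel₀ _ h1r.ne']
    simp only [hq, Complex.add_re] at h2
    linarith

/-- `fRatio Λ w` is the `ω` for which Julia's inequality at the origin, with `h 0 = w`, becomes an
equality. -/
theorem le_fRatio (hn : 1 ≤ n) (hΛ : ∀ k, Λ k < 0) {w : ℂ} {ω : ℝ} (hw : 0 < w.re) (hω : 0 < ω)
    (h : ‖w‖ ^ 2 ≤ 2 * (ω⁻¹ - sumInv Λ) * w.re) : ω ≤ fRatio Λ w := by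
  have hS := sumInv_pos hn hΛ
  rw [fRatio, le_div_iff₀ (by positivity)]
  calc ω * (‖w‖ ^ 2 + 2 * w.re * sumInv Λ)
      ≤ ω * (2 * (ω⁻¹ - sumInv Λ) * w.re + 2 * w.re * sumInv Λ) := by gcongr
    _ = 2 * w.re := by field_simp; ring

theorem fRatio_pos (hn : 1 ≤ n) (hΛ : ∀ k, Λ k < 0) {w : ℂ} (hw : 0 < w.re) :
    0 < fRatio Λ w := by
  have hS := sumInv_pos hn hΛ
  rw [fRatio]
  positivity

theorem inv_fRatio {w : ℂ} (hw : 0 < w.re) : (fRatio Λ w)⁻¹ = ‖w‖ ^ 2 / (2 * w.re) + sumInv Λ := by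
  rw [fRatio, inv_div]
  field_simp

/-- Equality in Julia's lemma determines the function. -/
theorem inv_eq_of_julia (hτ : ‖τ‖ = 1) {h : ℂ → ℂ} {D : ℝ} (hd : DifferentiableOn ℂ h disk)
    (hpos : ∀ z ∈ disk, 0 < (h z).re) (hD : 0 < D)
    (hJ : ∀ z ∈ disk, ‖h z‖ ^ 2 * (herglotz τ z).re ≤ 2 * D * (h z).re)
    (h0 : ‖h 0‖ ^ 2 = 2 * D * (h 0).re) {z : ℂ} (hz : z ∈ disk) :
    (h z)⁻¹ = (h 0)⁻¹ + ((2 * D)⁻¹ : ℝ) * (herglotz τ z - 1) := by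
  have hne : ∀ z ∈ disk, h z ≠ 0 := fun z hz h0 => by
    have := hpos z hz
    simp [h0] at this
  -- Julia's inequality says that `1 / h` minus this multiple of the kernel has nonnegative real
  -- part; equality at `0` makes the difference constant.
  have hc := eq_of_re_eq_zero (h := fun z => (h z)⁻¹ - ((2 * D)⁻¹ : ℝ) * herglotz τ z)
    ((hd.inv hne).sub ((differentiableOn_herglotz hτ).const_mul _)) (fun z hz => by
      have h1 := hJ z hz
      have h2 := norm_pos_iff.2 (hne z hz)
      rw [Complex.sub_re, Complex.re_ofReal_mul, re_inv_eq, sub_nonneg, inv_mul_le_iff₀ (by positivity),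
        ← mul_div_assoc, le_div_iff₀ (by positivity)]
      linarith) zero_mem_disk (by
      have h2 := norm_pos_iff.2 (hne 0 zero_mem_disk)
      have h3 := hpos 0 zero_mem_disk
      rw [herglotz_zero hτ, mul_one, Complex.sub_re, Complex.ofReal_re, re_inv_eq, h0]
      field_simp
      simp) z hz
  simp only [herglotz_zero hτ] at hc
  linear_combination hc

/-- For fixed `τ`, the Möbius map `s ↦ (s + τ) / (s - τ)` sends the circle without `τ` bijectively
onto the imaginary axis. -/
theorem existsUnique_herglotz_eq (hτ : ‖τ‖ = 1) {κ : ℂ} (hκ : κ.re = 0) :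
    ∃! s : ℂ, ‖s‖ = 1 ∧ s ≠ τ ∧ herglotz s τ = κ := by
  have hκ1 : κ - 1 ≠ 0 := by
    intro h
    have := congrArg Complex.re h
    simp [hκ] at this
  have hτ0 := ne_zero_of_norm_one hτ
  have hnorm : ‖κ + 1‖ = ‖κ - 1‖ := by
    have := normSq_add_conj_sub κ 1
    rw [hκ, map_one, mul_zero, zero_mul, sub_eq_zero] at this
    exact (pow_left_inj₀ (norm_nonneg _) (norm_nonneg _) two_ne_zero).1 this
  refine ⟨τ * ((κ + 1) / (κ - 1)), ⟨?_, ?_, ?_⟩, ?_⟩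
  · rw [norm_mul, hτ, one_mul, norm_div, hnorm, div_self (norm_ne_zero_iff.2 hκ1)]
  · intro h
    have h1 : (κ + 1) / (κ - 1) = 1 := mul_left_cancel₀ hτ0 (by rw [h, mul_one])
    rw [div_eq_one_iff_eq hκ1] at h1
    have : (2 : ℂ) = 0 := by linear_combination h1
    norm_num at this
  · have h1 : τ * ((κ + 1) / (κ - 1)) - τ = 2 * τ / (κ - 1) := by field_simp; ring
    rw [herglotz, h1]
    field_simp
    ring
  · rintro s ⟨-, hs2, hs3⟩
    rw [herglotz, div_eq_iff (sub_ne_zero.2 hs2)] at hs3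
    rw [← mul_div_assoc, eq_div_iff hκ1]
    linear_combination -hs3

/-! ### Geometry of the region `Z` and the exceptional boundary point. -/

/-- Since `A + ell = τ / ζ`, the norm on the left is `‖ζ‖ * ‖A - ell‖`, while `‖A + conj ell‖ = 1 /
‖ζ‖`. Thus membership in `Z` is a sign condition on `Re ell`. -/
theorem normSq_regionZ (hτ : ‖τ‖ = 1) (ζ : ℂ) :
    ‖(2 * τ⁻¹ * (sumAlpha τ σ Λ : ℂ)) * ζ - 1‖ ^ 2 =
      1 - 4 * sumAlpha τ σ Λ * ‖ζ‖ ^ 2 * (ell τ σ Λ ζ).re := by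
  rcases eq_or_ne ζ 0 with rfl | hζ
  · simp
  set A := sumAlpha τ σ Λ
  have hτ0 := ne_zero_of_norm_one hτ
  have h1 : (2 * τ⁻¹ * (A : ℂ)) * ζ - 1 = (ζ / τ) * ((A : ℂ) - ell τ σ Λ ζ) := by
    rw [ell]
    field_simp
    ring
  have h2 : ‖(A : ℂ) + conj (ell τ σ Λ ζ)‖ ^ 2 * ‖ζ‖ ^ 2 = 1 := by
    have h3 : ‖(A : ℂ) + conj (ell τ σ Λ ζ)‖ = ‖τ / ζ‖ := by
      rw [ell, map_sub, Complex.conj_ofReal, add_sub_cancel, RCLike.norm_conj]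
    have := norm_pos_iff.2 hζ
    rw [h3, norm_div, hτ]
    field_simp
  have h3 := normSq_add_conj_sub (A : ℂ) (ell τ σ Λ ζ)
  rw [Complex.ofReal_re] at h3
  rw [h1, norm_mul, norm_div, hτ, div_one, mul_pow]
  linear_combination h2 - ‖ζ‖ ^ 2 * h3

theorem norm_regionZ (hτ : ‖τ‖ = 1) (hA : 0 < sumAlpha τ σ Λ) (ζ : ℂ) :
    ‖(2 * τ⁻¹ * (sumAlpha τ σ Λ : ℂ)) * ζ - 1‖ =
      2 * sumAlpha τ σ Λ * dist ζ (τ / (2 * sumAlpha τ σ Λ)) := by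
  have hτ0 := ne_zero_of_norm_one hτ
  have hA' := Complex.ofReal_ne_zero.2 hA.ne'
  have h1 : (2 * τ⁻¹ * (sumAlpha τ σ Λ : ℂ)) * ζ - 1 =
      ((2 * sumAlpha τ σ Λ : ℝ) : ℂ) * τ⁻¹ * (ζ - τ / (2 * sumAlpha τ σ Λ)) := by
    push_cast
    field_simp
  rw [h1, norm_mul, norm_mul, norm_inv, hτ, inv_one, mul_one, Complex.norm_real,
    Real.norm_of_nonneg (by positivity), dist_eq_norm]

theorem regionZ_eq_closedBall (hτ : ‖τ‖ = 1) (hA : 0 < sumAlpha τ σ Λ) :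
    regionZ τ σ Λ = Metric.closedBall (τ / (2 * sumAlpha τ σ Λ)) (2 * sumAlpha τ σ Λ)⁻¹ := by
  ext ζ
  have h2A : 0 < 2 * sumAlpha τ σ Λ := by positivity
  rw [regionZ, mem_ofPred_eq, norm_regionZ hτ hA, Metric.mem_closedBall, ← one_div,
    le_div_iff₀' h2A]

theorem mem_regionZ_iff (hτ : ‖τ‖ = 1) (hA : 0 < sumAlpha τ σ Λ) {ζ : ℂ} (hζ : ζ ≠ 0) :
    ζ ∈ regionZ τ σ Λ ↔ 0 ≤ (ell τ σ Λ ζ).re := by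
  have h1 := normSq_regionZ (σ := σ) (Λ := Λ) hτ ζ
  have h2 : 0 < 4 * sumAlpha τ σ Λ * ‖ζ‖ ^ 2 := by
    have := norm_pos_iff.2 hζ
    positivity
  rw [regionZ, mem_ofPred_eq, ← sq_le_one_iff₀ (norm_nonneg _), h1, sub_le_self_iff,
    mul_nonneg_iff_of_pos_left h2]

theorem mem_interior_regionZ_iff (hτ : ‖τ‖ = 1) (hA : 0 < sumAlpha τ σ Λ) {ζ : ℂ} :
    ζ ∈ interior (regionZ τ σ Λ) ↔ ζ ≠ 0 ∧ 0 < (ell τ σ Λ ζ).re := by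
  have h2A : 0 < 2 * sumAlpha τ σ Λ := by positivity
  have h1 := normSq_regionZ (σ := σ) (Λ := Λ) hτ ζ
  rw [regionZ_eq_closedBall hτ hA, interior_closedBall _ (inv_pos.2 h2A).ne', Metric.mem_ball,
    ← one_div, lt_div_iff₀' h2A, ← norm_regionZ hτ hA, ← sq_lt_one_iff₀ (norm_nonneg _), h1,
    sub_lt_self_iff]
  rcases eq_or_ne ζ 0 with rfl | hζ
  · simp
  · have h2 : 0 < 4 * sumAlpha τ σ Λ * ‖ζ‖ ^ 2 := by
      have := norm_pos_iff.2 hζ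
      positivity
    rw [mul_pos_iff_of_pos_left h2]
    exact ⟨fun h => ⟨hζ, h⟩, fun h => h.2⟩

theorem mem_frontier_regionZ_iff (hτ : ‖τ‖ = 1) (hA : 0 < sumAlpha τ σ Λ) {ζ : ℂ} :
    ζ ∈ frontier (regionZ τ σ Λ) ↔ ζ = 0 ∨ (ell τ σ Λ ζ).re = 0 := by
  have h2A : 0 < 2 * sumAlpha τ σ Λ := by positivity
  have h1 := normSq_regionZ (σ := σ) (Λ := Λ) hτ ζ
  rw [regionZ_eq_closedBall hτ hA, frontier_closedBall _ (inv_pos.2 h2A).ne', Metric.mem_sphere,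
    ← one_div, eq_div_iff_mul_eq h2A.ne', mul_comm, ← norm_regionZ hτ hA,
    ← pow_eq_one_iff_of_nonneg (norm_nonneg _) two_ne_zero, h1, sub_eq_self]
  simp [hA.ne']

/-- Termwise, `1 - herglotz (σ k) τ = 2 τ / (τ - σ k)`, which cancels half of `‖τ - σ k‖ ^ 2` in
`α_k`. This turns `h 0 = 0` into the explicit condition of (ii). -/
theorem sumAlpha_sub_p0 (hτσ : ∀ k, τ ≠ σ k)
    (hΛ : ∀ k, Λ k < 0) : (sumAlpha τ σ Λ : ℂ) - p0 τ σ Λ τ =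
      τ * conj (∑ k, ((|Λ k|⁻¹ : ℝ) : ℂ) * (τ - σ k)) := by
  rw [sumAlpha, p0_eq, Complex.ofReal_sum, ← Finset.sum_sub_distrib, map_sum, Finset.mul_sum]
  refine Finset.sum_congr rfl fun k _ => ?_
  have h1 := sub_ne_zero.2 (hτσ k).symm
  have h2 := (abs_pos.2 (hΛ k).ne).ne'
  have h3 : ((alpha τ σ Λ k : ℝ) : ℂ) = ((|Λ k|⁻¹ : ℝ) : ℂ) * ((τ - σ k) * conj (τ - σ k)) / 2 := by
    rw [Complex.mul_conj, Complex.normSq_eq_norm_sq, alpha, ← Complex.ofReal_mul]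
    push_cast
    have : ((|Λ k| : ℝ) : ℂ) ≠ 0 := Complex.ofReal_ne_zero.2 h2
    field_simp
  rw [h3, map_mul, Complex.conj_ofReal, herglotz]
  field_simp
  ring

theorem paramValue_eq_zero_iff (hτ : ‖τ‖ = 1) (hτσ : ∀ k, τ ≠ σ k)
    (hΛ : ∀ k, Λ k < 0) (ζ : ℂ) : paramValue τ σ Λ ζ = 0 ↔
      1 / conj ζ = ∑ k, ((|Λ k|⁻¹ : ℝ) : ℂ) * (τ - σ k) := by
  have h1 := sumAlpha_sub_p0 hτσ hΛ
  have h2 : paramValue τ σ Λ ζ =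
      τ * conj (1 / conj ζ - ∑ k, ((|Λ k|⁻¹ : ℝ) : ℂ) * (τ - σ k)) := by
    rw [paramValue, ell, map_sub, map_div₀, Complex.conj_conj, map_one, mul_sub, ← h1]
    ring
  rw [h2, mul_eq_zero_iff_left (ne_zero_of_norm_one hτ), map_eq_zero, sub_eq_zero]

/-! ### Extremal generators and the fibres of the value region. -/

theorem extrGen_eq_genOf {ζ s : ℂ} (h0 : extrDenom τ σ Λ ζ s τ = 0) :
    extrGen τ σ Λ ζ s =
      genOf τ σ Λ fun z => ((ell τ σ Λ ζ).re : ℂ) * (herglotz s z - herglotz s τ) := by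
  funext z
  rw [extrGen, genOf]
  congr 1
  rw [extrDenom] at h0 ⊢
  simp only [herglotz]
  linear_combination h0

theorem spectralValue_nonneg (hτ : ‖τ‖ = 1) {G : ℂ → ℂ} {ω : ℝ} (hG : G ∈ Gen τ σ Λ)
    (hω : HasSpectralValueAt G τ ω) : 0 ≤ ω := by
  obtain ⟨ω', h1, h2⟩ := exists_spectralValue hτ hG
  rwa [spectralValue_unique hω h2]

theorem re_pos_of_re_zero_pos {h : ℂ → ℂ} (hd : DifferentiableOn ℂ h disk)
    (hpos : ∀ z ∈ disk, 0 ≤ (h z).re) (h0 : 0 < (h 0).re) : ∀ z ∈ disk, 0 < (h z).re := by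
  intro z hz
  refine lt_of_le_of_ne (hpos z hz) fun hz0 => h0.ne' ?_
  rw [eq_of_re_eq_zero hd hpos hz hz0.symm 0 zero_mem_disk, ← hz0]

theorem spectralValue_le_omegaMax (hn : 1 ≤ n) (hτ : ‖τ‖ = 1) (hσ : ∀ k, ‖σ k‖ = 1)
    (hinj : Function.Injective σ) (hτσ : ∀ k, τ ≠ σ k) (hΛ : ∀ k, Λ k < 0) {G : ℂ → ℂ} {ω : ℝ}
    (hG : G ∈ Gen τ σ Λ) (hG0 : G 0 ≠ 0) (hre : 0 < (ell τ σ Λ (G 0)).re)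
    (hω : HasSpectralValueAt G τ ω) : ω ≤ omegaMax τ σ Λ (G 0) := by
  rw [← paramValue_re hτ hσ hτσ hΛ] at hre
  rw [omegaMax_eq hτ hσ hτσ hΛ]
  obtain ⟨h, hd, hpos, h0, heq⟩ := exists_eq_genOf hn hτ hσ hinj hτσ hΛ hG hG0
  -- `ω = 0` is separate because the Julia estimate involves `ω⁻¹`.
  rcases (spectralValue_nonneg hτ hG hω).eq_or_lt with h1 | h1
  · rw [← h1]
    exact (fRatio_pos hn hΛ hre).le
  · refine le_fRatio hn hΛ hre h1 ?_
    rw [← h0] at hre ⊢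
    have := julia_genOf hτ hσ hτσ hΛ hd (re_pos_of_re_zero_pos hd hpos hre) h1 (hω.congr heq)
      zero_mem_disk
    rwa [herglotz_zero hτ, Complex.one_re, mul_one] at this

/-- Equality in Julia's lemma at the origin determines `h` from `h 0`, hence from `ζ`; two maximal
generators therefore agree without reference to the extremal formula. -/
theorem eqOn_of_spectralValue_eq_omegaMax (hn : 1 ≤ n) (hτ : ‖τ‖ = 1) (hσ : ∀ k, ‖σ k‖ = 1)
    (hinj : Function.Injective σ) (hτσ : ∀ k, τ ≠ σ k) (hΛ : ∀ k, Λ k < 0) {ζ : ℂ} (hζ : ζ ≠ 0)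
    (hre : 0 < (ell τ σ Λ ζ).re) {G G' : ℂ → ℂ} (hG : G ∈ Gen τ σ Λ) (hG' : G' ∈ Gen τ σ Λ)
    (h0 : G 0 = ζ) (h0' : G' 0 = ζ) (hω : HasSpectralValueAt G τ (omegaMax τ σ Λ ζ))
    (hω' : HasSpectralValueAt G' τ (omegaMax τ σ Λ ζ)) : EqOn G G' disk := by
  have hpr := hre
  rw [← paramValue_re hτ hσ hτσ hΛ] at hpr
  set w := paramValue τ σ Λ ζ with hw
  have hw0 : w ≠ 0 := fun h => by simp [h] at hpr
  have hwn := norm_pos_iff.2 hw0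
  rw [omegaMax_eq hτ hσ hτσ hΛ, ← hw] at hω hω'
  have hD : (fRatio Λ w)⁻¹ - sumInv Λ = ‖w‖ ^ 2 / (2 * w.re) := by
    rw [inv_fRatio hpr, add_sub_cancel_right]
  have key : ∀ {K : ℂ → ℂ}, K ∈ Gen τ σ Λ → K 0 = ζ → HasSpectralValueAt K τ (fRatio Λ w) →
      ∀ z ∈ disk, K z = genOf τ σ Λ
        (fun z => (w⁻¹ + ((2 * (‖w‖ ^ 2 / (2 * w.re)))⁻¹ : ℝ) * (herglotz τ z - 1))⁻¹) z := by
    intro K hK hK0 hKω z hz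
    obtain ⟨h, hd, hpos, hh0, heq⟩ :=
      exists_eq_genOf hn hτ hσ hinj hτσ hΛ hK (by rwa [hK0])
    rw [hK0, ← hw] at hh0
    have hp := re_pos_of_re_zero_pos hd hpos (by rwa [hh0])
    have hJ := fun z (hz : z ∈ disk) => julia_genOf hτ hσ hτσ hΛ hd hp (fRatio_pos hn hΛ hpr)
      (hKω.congr heq) hz
    rw [hD] at hJ
    have hinv := inv_eq_of_julia hτ hd hp (by positivity) hJ (by rw [hh0]; field_simp) hz
    rw [hh0] at hinv
    rw [heq hz, genOf, genOf, ← hinv, inv_inv]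
  intro z hz
  rw [key hG h0 hω z hz, key hG' h0' hω' z hz]

theorem exists_mem_gen_of_interior (hn : 1 ≤ n) (hτ : ‖τ‖ = 1) (hσ : ∀ k, ‖σ k‖ = 1)
    (hinj : Function.Injective σ) (hτσ : ∀ k, τ ≠ σ k) (hΛ : ∀ k, Λ k < 0) {ζ : ℂ} (hζ : ζ ≠ 0)
    (hre : 0 < (ell τ σ Λ ζ).re) {ω : ℝ} (hω0 : 0 ≤ ω) (hω : ω < omegaMax τ σ Λ ζ) :
    ∃ G ∈ Gen τ σ Λ, G 0 = ζ ∧ HasSpectralValueAt G τ ω := by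
  rw [← paramValue_re hτ hσ hτσ hΛ] at hre
  rw [omegaMax_eq hτ hσ hτσ hΛ] at hω
  set w := paramValue τ σ Λ ζ with hw
  have hw0 : w ≠ 0 := fun h => by simp [h] at hre
  have hwn := norm_pos_iff.2 hw0
  rcases hω0.eq_or_lt with rfl | hωpos
  · have h1 := genOf_const_mem hn hτ hσ hinj hτσ hΛ hw0 hre.le
    exact ⟨_, h1.1, genOf_apply_zero hτ hσ hζ rfl, h1.2⟩
  · have h1 : ‖w‖ ^ 2 / (2 * w.re) < ω⁻¹ - sumInv Λ := by
      have := (inv_lt_inv₀ (fRatio_pos hn hΛ hre) hωpos).2 hω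
      rw [inv_fRatio hre] at this
      linarith
    have h2 : 0 < ω⁻¹ - sumInv Λ := lt_trans (by positivity) h1
    -- `m` solves `(sumInv Λ + 1 / (2 * m))⁻¹ = ω`. Strictness of `ω < f w` amounts to `m < Re (1 /
    -- w)`, so `b = 1 / w - m` is admissible and gives `h 0 = w`.
    set m := (2 * (ω⁻¹ - sumInv Λ))⁻¹ with hm
    have hmpos : 0 < m := by positivity
    have h3 : m < (w⁻¹).re := by
      rw [re_inv_eq, hm, ← inv_div]
      refine (inv_lt_inv₀ (by positivity) (by positivity)).2 ?_
      calc ‖w‖ ^ 2 / w.re = 2 * (‖w‖ ^ 2 / (2 * w.re)) := by field_simp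
        _ < _ := by gcongr
    have h4 := genOf_inv_mem hn hτ hσ hinj hτσ hΛ hmpos (b := w⁻¹ - m) (by
      rw [Complex.sub_re, Complex.ofReal_re]; linarith)
    have h5 : (sumInv Λ + (2 * m)⁻¹)⁻¹ = ω := by
      have : (2 * m)⁻¹ = ω⁻¹ - sumInv Λ := by rw [hm]; field_simp
      rw [this, add_sub_cancel, inv_inv]
    rw [h5] at h4
    refine ⟨_, h4.1, genOf_apply_zero hτ hσ hζ ?_, h4.2⟩
    rw [herglotz_zero hτ, mul_one, add_sub_cancel, inv_inv]

theorem existsUnique_extrDenom_eq_zero (hτ : ‖τ‖ = 1) (hσ : ∀ k, ‖σ k‖ = 1)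
    (hτσ : ∀ k, τ ≠ σ k) (hΛ : ∀ k, Λ k < 0) {ζ : ℂ} (hre : 0 < (ell τ σ Λ ζ).re) :
    ∃! s : ℂ, ‖s‖ = 1 ∧ s ≠ τ ∧ extrDenom τ σ Λ ζ s τ = 0 := by
  have ha : ((ell τ σ Λ ζ).re : ℂ) ≠ 0 := Complex.ofReal_ne_zero.2 hre.ne'
  set κ : ℂ := -(Complex.I * ((ell τ σ Λ ζ).im : ℂ) + p0 τ σ Λ τ) / ((ell τ σ Λ ζ).re : ℂ)
  have hκ : κ.re = 0 := by
    rw [Complex.div_ofReal_re, Complex.neg_re, Complex.add_re, p0_boundary_re hτ hσ hτσ hΛ]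
    simp
  have hiff : ∀ s, extrDenom τ σ Λ ζ s τ = 0 ↔ herglotz s τ = κ := by
    intro s
    rw [extrDenom, eq_div_iff ha, herglotz, add_assoc, add_eq_zero_iff_eq_neg]
  simpa only [hiff] using existsUnique_herglotz_eq hτ hκ

theorem extrGen_mem (hn : 1 ≤ n) (hτ : ‖τ‖ = 1) (hσ : ∀ k, ‖σ k‖ = 1)
    (hinj : Function.Injective σ) (hτσ : ∀ k, τ ≠ σ k) (hΛ : ∀ k, Λ k < 0) {ζ s : ℂ} (hζ : ζ ≠ 0)
    (hre : 0 < (ell τ σ Λ ζ).re) (hs : ‖s‖ = 1) (hsτ : s ≠ τ)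
    (h0 : extrDenom τ σ Λ ζ s τ = 0) :
    extrGen τ σ Λ ζ s ∈ Gen τ σ Λ ∧ extrGen τ σ Λ ζ s 0 = ζ ∧
      HasSpectralValueAt (extrGen τ σ Λ ζ s) τ (omegaMax τ σ Λ ζ) := by
  have hmem := genOf_herglotz_mem hn hτ hσ hinj hτσ hΛ hre.le hs hsτ
  set a := (ell τ σ Λ ζ).re with ha
  have hw : paramValue τ σ Λ ζ = (a : ℂ) * (1 - herglotz s τ) := by
    rw [extrDenom, ← herglotz.eq_def, ← ha] at h0
    rw [paramValue]
    linear_combination h0 - Complex.re_add_im (ell τ σ Λ ζ)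
  -- Here `w = a * (1 - herglotz s τ) = 2 a τ / (τ - s)` has real part `a`, so `‖w‖ ^ 2 / (2 * Re w)
  -- = 2 a / ‖τ - s‖ ^ 2`, the slope of the extremal `h` at `τ`.
  have hval : omegaMax τ σ Λ ζ = (sumInv Λ + a * (2 / ‖τ - s‖ ^ 2))⁻¹ := by
    have hpr := hre
    rw [ha, ← paramValue_re hτ hσ hτσ hΛ] at hpr
    have hd := norm_pos_iff.2 (sub_ne_zero.2 hsτ.symm)
    have h1 : 1 - herglotz s τ = 2 * τ / (τ - s) := by
      have h2 := sub_ne_zero.2 hsτ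
      have h3 := sub_ne_zero.2 hsτ.symm
      rw [herglotz, one_sub_div h2, div_eq_div_iff h2 h3]
      ring
    rw [omegaMax_eq hτ hσ hτσ hΛ, ← inv_inv (fRatio _ _), inv_fRatio hpr,
      paramValue_re hτ hσ hτσ hΛ, ← ha, hw, h1, norm_mul, norm_div, norm_mul, hτ, Complex.norm_real,
      Real.norm_of_nonneg hre.le, Complex.norm_ofNat, add_comm]
    congr 2
    field_simp
  rw [extrGen_eq_genOf h0, ← ha, hval]
  refine ⟨hmem.1, genOf_apply_zero hτ hσ hζ ?_, hmem.2⟩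
  rw [herglotz_zero hs, hw]

/-- On the boundary of the region the generator is determined by its value at the origin. -/
theorem eqOn_genOf_const_of_re_eq_zero (hn : 1 ≤ n) (hτ : ‖τ‖ = 1) (hσ : ∀ k, ‖σ k‖ = 1)
    (hinj : Function.Injective σ) (hτσ : ∀ k, τ ≠ σ k) (hΛ : ∀ k, Λ k < 0) {G : ℂ → ℂ}
    (hG : G ∈ Gen τ σ Λ) (hG0 : G 0 ≠ 0) (hre : (ell τ σ Λ (G 0)).re = 0) :
    EqOn G (genOf τ σ Λ fun _ => paramValue τ σ Λ (G 0)) disk := by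
  rw [← paramValue_re hτ hσ hτσ hΛ] at hre
  obtain ⟨h, hd, hpos, h0, heq⟩ := exists_eq_genOf hn hτ hσ hinj hτσ hΛ hG hG0
  intro z hz
  rw [heq hz, genOf, genOf, ← h0,
    eq_of_re_eq_zero hd hpos zero_mem_disk (by rw [h0, hre]) z hz]

theorem mem_regionZ_of_mem_gen (hn : 1 ≤ n) (hτ : ‖τ‖ = 1) (hσ : ∀ k, ‖σ k‖ = 1)
    (hinj : Function.Injective σ) (hτσ : ∀ k, τ ≠ σ k) (hΛ : ∀ k, Λ k < 0) {G : ℂ → ℂ}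
    (hG : G ∈ Gen τ σ Λ) : G 0 ∈ regionZ τ σ Λ := by
  rcases eq_or_ne (G 0) 0 with h0 | h0
  · rw [h0]
    simp [regionZ]
  · rw [mem_regionZ_iff hτ (sumAlpha_pos hn hτσ hΛ) h0, ← paramValue_re hτ hσ hτσ hΛ]
    obtain ⟨h, -, hpos, hh0, -⟩ := exists_eq_genOf hn hτ hσ hinj hτσ hΛ hG h0
    rw [← hh0]
    exact hpos 0 zero_mem_disk

/-- `G 0 = 0` excludes `Re p > 0`, so `G` vanishes on the whole disk. -/
theorem spectralValue_eq_zero_of_apply_zero (hn : 1 ≤ n) (hτ : ‖τ‖ = 1) (hσ : ∀ k, ‖σ k‖ = 1)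
    (hτσ : ∀ k, τ ≠ σ k) (hΛ : ∀ k, Λ k < 0) {G : ℂ → ℂ} {ω : ℝ} (hG : G ∈ Gen τ σ Λ)
    (hG0 : G 0 = 0) (hω : HasSpectralValueAt G τ ω) : ω = 0 := by
  rcases eq_zero_or_berksonPorta_re_pos hn hτ hσ hτσ hG with h | h
  · exact spectralValue_unique (hω.congr (G' := fun _ => 0) h) (zero_mem_gen hτ hσ hΛ).2
  · have := h 0 zero_mem_disk
    simp [berksonPorta, hG0] at this

theorem fiber_interior (hn : 1 ≤ n) (hτ : ‖τ‖ = 1) (hσ : ∀ k, ‖σ k‖ = 1)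
    (hinj : Function.Injective σ) (hτσ : ∀ k, τ ≠ σ k) (hΛ : ∀ k, Λ k < 0) {ζ : ℂ}
    (hζ : ζ ∈ interior (regionZ τ σ Λ)) :
    {ω : ℝ | (ζ, ω) ∈ valueRegion τ σ Λ} = Icc 0 (omegaMax τ σ Λ ζ) := by
  obtain ⟨hζ0, hre⟩ := (mem_interior_regionZ_iff hτ (sumAlpha_pos hn hτσ hΛ)).1 hζ
  ext ω
  constructor
  · rintro ⟨G, hG, hG0, hω⟩
    simp only at hG0 hω
    subst hG0
    exact ⟨spectralValue_nonneg hτ hG hω,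
      spectralValue_le_omegaMax hn hτ hσ hinj hτσ hΛ hG hζ0 hre hω⟩
  · rintro ⟨h1, h2⟩
    rcases h2.eq_or_lt with rfl | h2
    · obtain ⟨s, ⟨hs1, hs2, hs3⟩, -⟩ := existsUnique_extrDenom_eq_zero hτ hσ hτσ hΛ hre
      exact ⟨_, extrGen_mem hn hτ hσ hinj hτσ hΛ hζ0 hre hs1 hs2 hs3⟩
    · exact exists_mem_gen_of_interior hn hτ hσ hinj hτσ hΛ hζ0 hre h1 h2

theorem fiber_frontier (hn : 1 ≤ n) (hτ : ‖τ‖ = 1) (hσ : ∀ k, ‖σ k‖ = 1)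
    (hinj : Function.Injective σ) (hτσ : ∀ k, τ ≠ σ k) (hΛ : ∀ k, Λ k < 0) {ζ : ℂ} {ω : ℝ}
    (hζ : ζ ≠ 0) (hre : (ell τ σ Λ ζ).re = 0)
    (hmem : genOf τ σ Λ (fun _ => paramValue τ σ Λ ζ) ∈ Gen τ σ Λ ∧
      HasSpectralValueAt (genOf τ σ Λ fun _ => paramValue τ σ Λ ζ) τ ω) :
    {ω : ℝ | (ζ, ω) ∈ valueRegion τ σ Λ} = {ω} := by
  ext ω'
  constructor
  · rintro ⟨G, hG, hG0, hω⟩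
    simp only at hG0 hω
    subst hG0
    exact spectralValue_unique
      (hω.congr (eqOn_genOf_const_of_re_eq_zero hn hτ hσ hinj hτσ hΛ hG hζ hre)) hmem.2
  · rintro rfl
    exact ⟨_, hmem.1, genOf_apply_zero hτ hσ hζ rfl, hmem.2⟩

theorem fiber_zero (hn : 1 ≤ n) (hτ : ‖τ‖ = 1) (hσ : ∀ k, ‖σ k‖ = 1)
    (hτσ : ∀ k, τ ≠ σ k) (hΛ : ∀ k, Λ k < 0) :
    {ω : ℝ | ((0 : ℂ), ω) ∈ valueRegion τ σ Λ} = {0} := by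
  ext ω
  constructor
  · rintro ⟨G, hG, hG0, hω⟩
    exact spectralValue_eq_zero_of_apply_zero hn hτ hσ hτσ hΛ hG hG0 hω
  · rintro rfl
    exact ⟨_, (zero_mem_gen hτ hσ hΛ).1, rfl, (zero_mem_gen hτ hσ hΛ).2⟩

/-- After conjugation and multiplication by `τ` the sum has real part `sumAlpha > 0`. Needed at `ζ =
0`, where `1 / conj ζ` is `0` by convention and must not meet the exceptional condition. -/
theorem sum_inv_mul_sub_ne_zero (hn : 1 ≤ n) (hτ : ‖τ‖ = 1) (hσ : ∀ k, ‖σ k‖ = 1)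
    (hτσ : ∀ k, τ ≠ σ k) (hΛ : ∀ k, Λ k < 0) :
    ∑ k, ((|Λ k|⁻¹ : ℝ) : ℂ) * (τ - σ k) ≠ 0 := by
  intro h
  have h1 := congrArg Complex.re (sumAlpha_sub_p0 hτσ hΛ)
  rw [h, map_zero, mul_zero, Complex.sub_re, p0_boundary_re hτ hσ hτσ hΛ, Complex.ofReal_re,
    sub_zero, Complex.zero_re] at h1
  exact (sumAlpha_pos hn hτσ hΛ).ne' h1

end

end HolSemigroup
end

/-! ### The value region. -/

open HolSemigroup
theorem mainTheorem4 {n : ℕ} (hn : 1 ≤ n) (τ : ℂ) (σ : Fin n → ℂ) (Λ : Fin n → ℝ)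
    (hτ : ‖τ‖ = 1) (hσ : ∀ k, ‖σ k‖ = 1) (hσ_inj : Function.Injective σ)
    (hτσ : ∀ k, τ ≠ σ k) (hΛ : ∀ k, Λ k < 0) :
    -- the spectral value at `τ` is well defined on the class
    (∀ G ∈ Gen τ σ Λ, ∃! ω : ℝ, HasSpectralValueAt G τ ω) ∧
    -- the value region
    (∃ I : ℂ → Set ℝ,
      valueRegion τ σ Λ = {v : ℂ × ℝ | v.1 ∈ regionZ τ σ Λ ∧ v.2 ∈ I v.1} ∧
      (∀ ζ ∈ interior (regionZ τ σ Λ), I ζ = Set.Icc 0 (omegaMax τ σ Λ ζ)) ∧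
      (∀ ζ ∈ frontier (regionZ τ σ Λ),
        (1 / (starRingEnd ℂ) ζ = ∑ k, ((|Λ k|⁻¹ : ℝ) : ℂ) * (τ - σ k) →
          I ζ = {(sumInv Λ)⁻¹}) ∧
        (1 / (starRingEnd ℂ) ζ ≠ ∑ k, ((|Λ k|⁻¹ : ℝ) : ℂ) * (τ - σ k) →
          I ζ = {0}))) ∧
    -- the unique generator with maximal spectral value
    (∀ ζ ∈ interior (regionZ τ σ Λ),
      (∃! s : ℂ, ‖s‖ = 1 ∧ s ≠ τ ∧ extrDenom τ σ Λ ζ s τ = 0) ∧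
      ∀ s : ℂ, ‖s‖ = 1 → s ≠ τ → extrDenom τ σ Λ ζ s τ = 0 →
        (extrGen τ σ Λ ζ s ∈ Gen τ σ Λ ∧ extrGen τ σ Λ ζ s 0 = ζ ∧
          HasSpectralValueAt (extrGen τ σ Λ ζ s) τ (omegaMax τ σ Λ ζ)) ∧
        ∀ G ∈ Gen τ σ Λ, G 0 = ζ → HasSpectralValueAt G τ (omegaMax τ σ Λ ζ) →
          Set.EqOn G (extrGen τ σ Λ ζ s) disk) := by
  have hA := sumAlpha_pos hn hτσ hΛ
  -- `I ζ` is taken to be the fibre of the value region over `ζ`, so the set equality reduces to `G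
  -- 0 ∈ Z`.
  refine ⟨fun G hG => ?_, ⟨fun ζ => {ω | (ζ, ω) ∈ valueRegion τ σ Λ}, ?_,
    fun ζ hζ => fiber_interior hn hτ hσ hσ_inj hτσ hΛ hζ, fun ζ hζ => ?_⟩, fun ζ hζ => ?_⟩
  · obtain ⟨ω, -, hω⟩ := exists_spectralValue hτ hG
    exact ⟨ω, hω, fun ω' hω' => spectralValue_unique hω' hω⟩
  · ext ⟨ζ, ω⟩
    refine ⟨fun hv => ⟨?_, hv⟩, fun hv => hv.2⟩
    obtain ⟨G, hG, hG0, -⟩ := hv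
    exact hG0 ▸ mem_regionZ_of_mem_gen hn hτ hσ hσ_inj hτσ hΛ hG
  · rcases eq_or_ne ζ 0 with rfl | hζ0
    · refine ⟨fun h => ?_, fun _ => fiber_zero hn hτ hσ hτσ hΛ⟩
      rw [map_zero, div_zero] at h
      exact absurd h.symm (sum_inv_mul_sub_ne_zero hn hτ hσ hτσ hΛ)
    · have hre := ((mem_frontier_regionZ_iff hτ hA).1 hζ).resolve_left hζ0
      have hpr := hre
      rw [← paramValue_re hτ hσ hτσ hΛ] at hpr
      rw [Ne, ← paramValue_eq_zero_iff hτ hτσ hΛ]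
      refine ⟨fun h => ?_, fun h => ?_⟩
      · exact fiber_frontier hn hτ hσ hσ_inj hτσ hΛ hζ0 hre
          (h ▸ genOf_zero_mem hn hτ hσ hσ_inj hτσ hΛ)
      · exact fiber_frontier hn hτ hσ hσ_inj hτσ hΛ hζ0 hre
          (genOf_const_mem hn hτ hσ hσ_inj hτσ hΛ h hpr.ge)
  · obtain ⟨hζ0, hre⟩ := (mem_interior_regionZ_iff hτ hA).1 hζ
    refine ⟨existsUnique_extrDenom_eq_zero hτ hσ hτσ hΛ hre, fun s hs hsτ h0 => ?_⟩
    have hmem := extrGen_mem hn hτ hσ hσ_inj hτσ hΛ hζ0 hre hs hsτ h0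
    exact ⟨hmem, fun G hG hG0 hω => eqOn_of_spectralValue_eq_omegaMax hn hτ hσ hσ_inj hτσ hΛ hζ0
      hre hG hmem.1 hG0 hmem.2.1 hω hmem.2.2⟩
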